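/- Let $A$ be a finite-dimensional algebra over a field $k$, let $D=\operatorname{Hom}_k(-,k)$ be the standard duality, and let $\tau=D\operatorname{Tr}$ and $\tau^{-1}=\operatorname{Tr}D$ be the Auslander–Reiten translations. For $n\ge 1$, a finitely generated right $A$-module $M$ is called $n$-torsion-free if $\operatorname{Ext}^i_A(D(A),\tau M)=0$ for all $1\le i\le n$. The algebra $A$ has $n$-torsion-free Auslander–Reiten sequences if for every finitely generated indecomposable projective non-injective right $A$-module $U$ and every almost split sequence $0\to U\to X\to\tau^{-1}U\to 0$, the modules $U$, $X$ and $\tau^{-1}U$ are all $n$-torsion-free. The dominant dimension of a module with minimal injective coresolution $0\to M\to I_0\to I_1\to\cdots$ is the largest $m\in\mathbb{N}\cup\{\infty\}$ such that $I_i$ is projective for all $i<m$. **Theorem 3.1.** Let $n\ge 1$ and suppose that $A$ has $n$-torsion-free Auslander–Reiten sequences. Then $\operatorname{domdim}A\ge n$; that is, $A$ has dominant dimension at least $n$, both as a left and as a right module over itself. -/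

import Mathlib

universe u

/-!
Conventions. A right module over a ring `A` is a module over `Aᵐᵒᵖ`, and `A` itself is regarded as
a left module (over `A`) and as a right module (over `Aᵐᵒᵖ`) with the usual multiplication actions.
Modules are objects of `ModuleCat`, finite generation is `Module.Finite`.
-/

namespace ARSeq

/-! ### Superfluous and essential submodules -/

/-- `N` is a superfluous (small) submodule of `M`. -/
def IsSuperfluous {R M : Type*} [Ring R] [AddCommGroup M] [Module R M]
    (N : Submodule R M) : Prop :=
  ∀ K : Submodule R M, N ⊔ K = ⊤ → K = ⊤

/-- `N` is an essential (large) submodule of `M`. -/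
def IsEssential {R M : Type*} [Ring R] [AddCommGroup M] [Module R M]
    (N : Submodule R M) : Prop :=
  ∀ K : Submodule R M, N ⊓ K = ⊥ → K = ⊥

/-! ### Dominant dimension -/

/-- A minimal injective coresolution `0 → M → I 0 → I 1 → ⋯`: every term is an injective hull
of the image of the preceding map. -/
structure MinimalInjectiveCoresolution (R : Type u) [Ring R] (M : Type u) [AddCommGroup M]
    [Module R M] where
  I : ℕ → ModuleCat.{u} R
  ι : M →ₗ[R] I 0
  d : ∀ i : ℕ, I i →ₗ[R] I (i + 1)
  injective_term : ∀ i : ℕ, Module.Injective R (I i)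
  injective_ι : Function.Injective ι
  exact_zero : Function.Exact ι (d 0)
  exact_succ : ∀ i : ℕ, Function.Exact (d i) (d (i + 1))
  essential_zero : IsEssential (LinearMap.range ι)
  essential_succ : ∀ i : ℕ, IsEssential (LinearMap.range (d i))

/-- The dominant dimension of the `R`-module `M`: the largest `n ∈ ℕ ∪ {∞}` such that the terms
`I i` with `i < n` of a minimal injective coresolution of `M` are projective. -/
noncomputable def domDim (R : Type u) [Ring R] (M : Type u) [AddCommGroup M] [Module R M] : ℕ∞ :=
  sSup {n : ℕ∞ | ∃ C : MinimalInjectiveCoresolution R M,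
    ∀ i : ℕ, (i : ℕ∞) < n → Module.Projective R (C.I i)}

/-! ### The standard duality `D = Hom_k(-, k)` -/

/-- The `k`-dual `D M = Hom_k(M, k)` of a module `M` over a `k`-algebra `R`; here `k` acts on `M`
through `R`. -/
def StdDual (k R M : Type*) [Field k] [Ring R] [Algebra k R] [AddCommGroup M] [Module R M] :
    Type _ :=
  Module.Dual k (RestrictScalars k R M)

noncomputable section

variable (k R M : Type*) [Field k] [Ring R] [Algebra k R] [AddCommGroup M]

instance [Module R M] : AddCommGroup (StdDual k R M) :=
  inferInstanceAs (AddCommGroup (Module.Dual k (RestrictScalars k R M)))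

/-- The dual of a left module is a right module: `(f r) x = f (r x)`. -/
instance [Module R M] : Module Rᵐᵒᵖ (StdDual k R M) where
  smul r f := LinearMap.comp f (RestrictScalars.lsmul k R M r.unop)
  one_smul f := by
    change LinearMap.comp f (RestrictScalars.lsmul k R M 1) = f
    rw [map_one]; rfl
  mul_smul r s f := by
    change LinearMap.comp f (RestrictScalars.lsmul k R M (s.unop * r.unop)) = _
    rw [map_mul]; rfl
  smul_zero r := LinearMap.zero_comp _
  smul_add r f g := LinearMap.add_comp _ _ _
  add_smul r s f := by
    change LinearMap.comp f (RestrictScalars.lsmul k R M (r.unop + s.unop)) = _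
    rw [map_add]; exact LinearMap.comp_add _ _ _
  zero_smul f := by
    change LinearMap.comp f (RestrictScalars.lsmul k R M 0) = _
    rw [map_zero]; exact LinearMap.comp_zero _

/-- The dual of a right module is a left module: `(r f) x = f (x r)`. -/
instance [Module Rᵐᵒᵖ M] : Module R (StdDual k Rᵐᵒᵖ M) :=
  Module.compHom (StdDual k Rᵐᵒᵖ M) (RingEquiv.opOp R).toRingHom

end

/-! ### Transpose and Auslander-Reiten translations -/

/-- `P₁ → P₀ → M → 0`, with maps `f` and `p`, is a minimal projective presentation of `M` by
finitely generated modules: `P₀ → M` and `P₁ → ker p` are projective covers. -/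
structure IsMinimalProjectivePresentation {R : Type*} [Ring R] {P₁ P₀ M : Type*}
    [AddCommGroup P₁] [AddCommGroup P₀] [AddCommGroup M] [Module R P₁] [Module R P₀] [Module R M]
    (f : P₁ →ₗ[R] P₀) (p : P₀ →ₗ[R] M) : Prop where
  finite_one : Module.Finite R P₁
  finite_zero : Module.Finite R P₀
  projective_one : Module.Projective R P₁
  projective_zero : Module.Projective R P₀
  exact : Function.Exact f p
  surjective : Function.Surjective p
  superfluous_zero : IsSuperfluous (LinearMap.ker p)
  superfluous_one : IsSuperfluous (LinearMap.ker f)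

/-- `T` is a transpose of the `R`-module `M`: for a minimal projective presentation
`P₁ → P₀ → M → 0`, it is isomorphic to the cokernel of `Hom_R(P₀, B) → Hom_R(P₁, B)`.
Here `B` is a bimodule for `R` and `S`. For right modules over `A` one takes
`(R, S, B) = (Aᵐᵒᵖ, A, A)`, for left modules `(R, S, B) = (A, Aᵐᵒᵖ, A)`. -/
def IsTranspose (R S B : Type u) [Ring R] [Ring S] [AddCommGroup B] [Module R B] [Module S B]
    [SMulCommClass R S B] (M T : Type u) [AddCommGroup M] [Module R M] [AddCommGroup T]
    [Module S T] : Prop :=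
  ∃ (P₁ P₀ : ModuleCat.{u} R) (f : P₁ →ₗ[R] P₀) (p : P₀ →ₗ[R] M),
    IsMinimalProjectivePresentation f p ∧
      Nonempty (T ≃ₗ[S] ((P₁ →ₗ[R] B) ⧸ LinearMap.range (LinearMap.lcomp S B f)))

variable (k A : Type u) [Field k] [Ring A] [Algebra k A]

/-- `N` is isomorphic to the Auslander-Reiten translate `τ M = D (Tr M)` of the right module
`M`. -/
def IsTranslate (M N : ModuleCat.{u} Aᵐᵒᵖ) : Prop :=
  ∃ T : ModuleCat.{u} A, IsTranspose Aᵐᵒᵖ A A M T ∧ Nonempty (N ≃ₗ[Aᵐᵒᵖ] StdDual k A T)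

/-- `N` is isomorphic to the inverse Auslander-Reiten translate `τ⁻¹ M = Tr (D M)` of the right
module `M`. -/
def IsInverseTranslate (M N : ModuleCat.{u} Aᵐᵒᵖ) : Prop :=
  IsTranspose A Aᵐᵒᵖ A (StdDual k Aᵐᵒᵖ M) N

/-! ### Torsion-free modules and almost split sequences -/

/-- The right module `M` is `n`-torsion-free: `Ext^i_A(D A, τ M) = 0` for `1 ≤ i ≤ n`. -/
def IsTorsionFree (n : ℕ) (M : ModuleCat.{u} Aᵐᵒᵖ) : Prop :=
  ∃ N : ModuleCat.{u} Aᵐᵒᵖ, IsTranslate k A M N ∧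
    ∀ i : ℕ, 1 ≤ i → i ≤ n →
      Subsingleton (CategoryTheory.Abelian.Ext (ModuleCat.of Aᵐᵒᵖ (StdDual k A A)) N i)

/-- `0 → U → X → V → 0`, with maps `f` and `g`, is an almost split sequence of finitely generated
modules: it is exact, `f` is left almost split and `g` is right almost split. -/
structure IsAlmostSplit {R : Type u} [Ring R] {U X V : ModuleCat.{u} R}
    (f : U →ₗ[R] X) (g : X →ₗ[R] V) : Prop where
  finite_left : Module.Finite R U
  finite_middle : Module.Finite R X
  finite_right : Module.Finite R V
  injective : Function.Injective f
  exact : Function.Exact f g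
  surjective : Function.Surjective g
  not_split_mono : ¬ ∃ r : X →ₗ[R] U, r ∘ₗ f = LinearMap.id
  left_almost_split : ∀ (W : ModuleCat.{u} R) (h : U →ₗ[R] W), Module.Finite R W →
    (¬ ∃ r : W →ₗ[R] U, r ∘ₗ h = LinearMap.id) → ∃ h' : X →ₗ[R] W, h' ∘ₗ f = h
  not_split_epi : ¬ ∃ s : V →ₗ[R] X, g ∘ₗ s = LinearMap.id
  right_almost_split : ∀ (W : ModuleCat.{u} R) (h : W →ₗ[R] V), Module.Finite R W →
    (¬ ∃ s : V →ₗ[R] W, h ∘ₗ s = LinearMap.id) → ∃ h' : W →ₗ[R] X, g ∘ₗ h' = h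

/-- `A` has `n`-torsion-free Auslander-Reiten sequences: for every finitely generated
indecomposable projective non-injective right module `U`, all three terms of every almost split
sequence `0 → U → X → τ⁻¹ U → 0` are `n`-torsion-free. -/
def HasTorsionFreeARSequences (n : ℕ) : Prop :=
  ∀ U : ModuleCat.{u} Aᵐᵒᵖ, Module.Finite Aᵐᵒᵖ U → CategoryTheory.Indecomposable U →
    Module.Projective Aᵐᵒᵖ U → ¬ Module.Injective Aᵐᵒᵖ U →
    ∀ (X V : ModuleCat.{u} Aᵐᵒᵖ) (f : U →ₗ[Aᵐᵒᵖ] X) (g : X →ₗ[Aᵐᵒᵖ] V),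
      IsInverseTranslate k A U V → IsAlmostSplit f g →
      IsTorsionFree k A n U ∧ IsTorsionFree k A n X ∧ IsTorsionFree k A n V

end ARSeq

/-!
Call a module torsion if it has no nonzero maps to finitely generated modules which are both
projective and injective, and say that `M` has torsion depth at least `m` if `Ext^i(T, M) = 0` for
all torsion modules `T` and all `i < m`. The proof consists in computing the torsion depth of
projective modules.

*Depth and dominant dimension.* A finitely generated module of positive depth embeds in a
projective-injective module, because the smallest kernel of a map to such a module is torsion. So
its injective hull is projective, and the cosyzygy has depth one less. Therefore depth at least `n`
gives dominant dimension at least `n` (`le_domDim_of_hasTorsionDepth`).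

*Right modules.* By induction suppose that projective right modules have depth at least `n - 1`. If
`X` is `n`-torsion-free, then duality turns the hypothesis into `Ext^i(Tr X, A) = 0` for
`1 ≤ i ≤ n`, and this embeds `X` in a projective module with cokernel of depth at least `n - 1`
(`exists_embedding_of_extZero_transpose`). For an almost split sequence `0 → U → X → τ⁻¹ U → 0`
both `X` and `τ⁻¹ U` embed in this way; so `τ⁻¹ U` has depth at least `n - 1`, and the composite
`q : U → X → Q`, where `Q` is the projective module attached to `X`, induces injections
`Ext^i(T, U) → Ext^i(T, Q)` for torsion modules `T` and `i < n`. It is not a split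
monomorphism, hence its image lies in the radical of `Q`
(`range_le_jacobson_of_not_split`). An indecomposable projective-injective module has infinite
depth, so that there the zero map will do. Taking direct sums, every finitely generated projective
module has a radical map with this injectivity property to another one
(`hasRadicalEmbedding_of_indecomposable`). As the radical is nilpotent, a long composite of such
maps is zero, and yet it is injective on `Ext^i(T, -)`; so projective right modules have depth at
least `n` (`hasTorsionDepth_of_hasRadicalEmbedding`). The definition of torsion-free
Auslander-Reiten sequences speaks of all almost split sequences that start at `U`, and so their
existence is needed; it is proved in `exists_isAlmostSplit`.

*Left modules.* The depth of the projective modules is left-right symmetric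
(`hasTorsionDepth_symm`). Every finitely generated right module `Z` has a map `F → Z` with torsion
cokernel, where `F` is projective and `F* = Hom(F, A)` is projective and injective
(`exists_hom_isTorsion_coker`). With the vanishing of `Ext^i(C, A)` for torsion modules `C`,
dimension shifting along such maps shows that `Z*` has the required depth if `Ext^i(Z, A) = 0` for
`i > 0` (`extZero_dual`), which applies to the duals `Z` of projective left modules.

To treat left and right modules at the same time, the lemmas are about two rings `R` and `S` and a
bimodule `B` over them which is free of rank one on either side (`IsRegularBimodule`), and duality
is expressed by perfect pairings (`DualPair`).
-/

namespace ARSeq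

set_option linter.unusedSectionVars false

/-! ### Duality for modules over a finite-dimensional algebra -/

/-- The bimodule `B` is a regular bimodule with generator `e`: it is free of rank one on `e` over
`R` and over `S`, so that `r • e = s • e` identifies `S` with the opposite of `R`. This condition is
symmetric in `R` and `S`, and it covers `A` both as a bimodule over `(A, Aᵐᵒᵖ)` and over
`(Aᵐᵒᵖ, A)`. -/
structure IsRegularBimodule (k R S : Type u) {B : Type u} [Field k] [Ring R] [Ring S]
    [Algebra k R] [Algebra k S] [AddCommGroup B] [Module R B] [Module S B] (e : B) : Prop where
  bijective_left : Function.Bijective fun r : R => r • e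
  bijective_right : Function.Bijective fun s : S => s • e
  algebraMap_smul : ∀ c : k, algebraMap k R c • e = algebraMap k S c • e

/-- A perfect duality over `k` between an `R`-module `M` and an `S`-module `N`, where `R` and `S`
are opposite to each other through the regular bimodule generated by `e`. For finite-dimensional
modules it says that `N` is the standard dual of `M`, in a form which is symmetric in `M` and
`N`. -/
structure DualPair (k R S : Type u) {B : Type u} [Field k] [Ring R] [Ring S]
    [Algebra k R] [AddCommGroup B] [Module R B] [Module S B] (e : B)
    (M N : Type u) [AddCommGroup M] [Module R M] [AddCommGroup N] [Module S N] where
  form : M →+ N →+ k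
  smul_left : ∀ (c : k) (m : M) (n : N), form (algebraMap k R c • m) n = c * form m n
  balanced : ∀ (r : R) (s : S), r • e = s • e → ∀ (m : M) (n : N),
    form (r • m) n = form m (s • n)
  sep_left : ∀ m : M, (∀ n : N, form m n = 0) → m = 0
  sep_right : ∀ n : N, (∀ m : M, form m n = 0) → n = 0

section

variable {k R S B : Type u} [Field k] [Ring R] [Ring S] [Algebra k R] [Algebra k S]
  [AddCommGroup B] [Module R B] [Module S B] {e : B}

theorem IsRegularBimodule.symm (h : IsRegularBimodule k R S e) : IsRegularBimodule k S R e :=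
  ⟨h.bijective_right, h.bijective_left, fun c => (h.algebraMap_smul c).symm⟩

theorem isRegularBimodule_left (k A : Type u) [Field k] [Ring A] [Algebra k A] :
    IsRegularBimodule k A Aᵐᵒᵖ (1 : A) where
  bijective_left := by
    simp only [smul_eq_mul, mul_one]; exact Function.bijective_id
  bijective_right := by
    simp only [MulOpposite.smul_eq_mul_unop, one_mul]; exact MulOpposite.unop_bijective
  algebraMap_smul c := by simp [MulOpposite.smul_eq_mul_unop]

theorem isRegularBimodule_right (k A : Type u) [Field k] [Ring A] [Algebra k A] :
    IsRegularBimodule k Aᵐᵒᵖ A (1 : A) :=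
  (isRegularBimodule_left k A).symm

variable {M N M' N' M'' N'' : Type u} [AddCommGroup M] [Module R M] [AddCommGroup N] [Module S N]
  [AddCommGroup M'] [Module R M'] [AddCommGroup N'] [Module S N']
  [AddCommGroup M''] [Module R M''] [AddCommGroup N''] [Module S N'']

/-- The duality with the roles of the two modules exchanged. -/
def DualPair.symm (hB : IsRegularBimodule k R S e) (d : DualPair k R S e M N) :
    DualPair k S R e N M where
  form := d.form.flip
  smul_left c n m := by
    simp only [AddMonoidHom.flip_apply]
    rw [← d.balanced _ _ (hB.algebraMap_smul c), d.smul_left]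
  balanced s r h n m := (d.balanced r s h.symm m n).symm
  sep_left := d.sep_right
  sep_right := d.sep_left

@[simp]
theorem DualPair.symm_form (hB : IsRegularBimodule k R S e) (d : DualPair k R S e M N) (m : M)
    (n : N) : (d.symm hB).form n m = d.form m n := rfl

theorem DualPair.ext_right (d : DualPair k R S e M N) {n n' : N}
    (h : ∀ m, d.form m n = d.form m n') : n = n' :=
  sub_eq_zero.1 (d.sep_right _ fun m => by rw [map_sub, h, sub_self])

theorem DualPair.ext_left (d : DualPair k R S e M N) {m m' : M}
    (h : ∀ n, d.form m n = d.form m' n) : m = m' :=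
  sub_eq_zero.1 (d.sep_left _ fun n => by rw [map_sub, AddMonoidHom.sub_apply, h, sub_self])

theorem DualPair.smul_right (hB : IsRegularBimodule k R S e) (d : DualPair k R S e M N) (c : k)
    (m : M) (n : N) : d.form m (algebraMap k S c • n) = c * d.form m n :=
  (d.symm hB).smul_left c n m

/-- In finite dimensions a duality which separates points is perfect: every functional on `M`
is represented by an element of `N`. -/
theorem DualPair.exists_form_eq [Module.Finite k R] [Module.Finite R M]
    (hB : IsRegularBimodule k R S e) (d : DualPair k R S e M N) (φ : M →+ k)
    (hφ : ∀ (c : k) (m : M), φ (algebraMap k R c • m) = c * φ m) :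
    ∃ n, ∀ m, d.form m n = φ m := by
  let : Module k M := Module.compHom M (algebraMap k R)
  let : Module k N := Module.compHom N (algebraMap k S)
  have : IsScalarTower k R M := ⟨fun c r m => by
    rw [Algebra.smul_def, mul_smul]; rfl⟩
  have : Module.Finite k M := Module.Finite.trans R M
  let b : N →ₗ[k] Module.Dual k M :=
    { toFun := fun n =>
        { toFun := fun m => d.form m n
          map_add' := fun x y => by simp
          map_smul' := fun c m => d.smul_left c m n }
      map_add' := fun x y => by ext m; simp
      map_smul' := fun c n => by ext m; exact d.smul_right hB c m n }
  have hb : Function.Injective b := (injective_iff_map_eq_zero b).2 fun n hn =>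
    d.sep_right n fun m => congr($hn m)
  have : Module.Finite k N := Module.Finite.of_injective b hb
  let b' : M →ₗ[k] Module.Dual k N := b.flip
  have hb' : Function.Injective b' := (injective_iff_map_eq_zero b').2 fun n hn =>
    d.sep_left n fun m => congr($hn m)
  have h1 := LinearMap.finrank_le_finrank_of_injective hb
  have h2 := LinearMap.finrank_le_finrank_of_injective hb'
  rw [Subspace.dual_finrank_eq] at h1 h2
  have hs : Function.Surjective b :=
    (LinearMap.injective_iff_surjective_of_finrank_eq_finrank
      (by rw [Subspace.dual_finrank_eq]; omega)).1 hb
  obtain ⟨n, hn⟩ := hs { φ with map_smul' := hφ }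
  exact ⟨n, fun m => congr($hn m)⟩

/-- The dual of a finitely generated module is finitely generated. -/
theorem DualPair.finite_right [Module.Finite k R] [Module.Finite R M]
    (hB : IsRegularBimodule k R S e) (d : DualPair k R S e M N) : Module.Finite S N := by
  let : Module k M := Module.compHom M (algebraMap k R)
  let : Module k N := Module.compHom N (algebraMap k S)
  have : IsScalarTower k R M := ⟨fun c r m => by
    rw [Algebra.smul_def, mul_smul]; rfl⟩
  have : IsScalarTower k S N := ⟨fun c r m => by
    rw [Algebra.smul_def, mul_smul]; rfl⟩
  have : Module.Finite k M := Module.Finite.trans R M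
  let b : N →ₗ[k] Module.Dual k M :=
    { toFun := fun n =>
        { toFun := fun m => d.form m n
          map_add' := fun x y => by simp
          map_smul' := fun c m => d.smul_left c m n }
      map_add' := fun x y => by ext m; simp
      map_smul' := fun c n => by ext m; exact d.smul_right hB c m n }
  have hb : Function.Injective b := (injective_iff_map_eq_zero b).2 fun n hn =>
    d.sep_right n fun m => congr($hn m)
  have : Module.Finite k N := Module.Finite.of_injective b hb
  exact Module.Finite.of_restrictScalars_finite k S N

/-- The standard duality is full: every `R`-linear map has a transpose. -/
theorem DualPair.exists_transpose [Module.Finite k R] [Module.Finite R M]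
    (hB : IsRegularBimodule k R S e) (d : DualPair k R S e M N) (d' : DualPair k R S e M' N')
    (h : M →ₗ[R] M') : ∃ h' : N' →ₗ[S] N, ∀ m n', d.form m (h' n') = d'.form (h m) n' := by
  have key : ∀ n' : N', ∃ n, ∀ m, d.form m n = d'.form (h m) n' := fun n' =>
    d.exists_form_eq hB ((d'.form.flip n').comp h.toAddMonoidHom) fun c m => by
      simp [d'.smul_left]
  choose t ht using key
  refine ⟨{ toFun := t, map_add' := fun x y => ?_, map_smul' := fun s x => ?_ },
    fun m n' => ht n' m⟩
  · exact d.ext_right fun m => by simp [ht]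
  · obtain ⟨r, hr⟩ := hB.bijective_left.2 (s • e)
    refine d.ext_right fun m => ?_
    rw [ht, RingHom.id_apply, ← d.balanced r s hr, ht, LinearMap.map_smul, d'.balanced r s hr]

/-- Transposes of injective maps are surjective. -/
theorem DualPair.surjective_of_injective [Module.Finite k R] [Module.Finite R M']
    (hB : IsRegularBimodule k R S e) (d : DualPair k R S e M N) (d' : DualPair k R S e M' N')
    {h : M →ₗ[R] M'} {h' : N' →ₗ[S] N} (hh : ∀ m n', d.form m (h' n') = d'.form (h m) n')
    (hi : Function.Injective h) : Function.Surjective h' := by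
  intro n
  let : Module k M := Module.compHom M (algebraMap k R)
  let : Module k M' := Module.compHom M' (algebraMap k R)
  let hk : M →ₗ[k] M' := { h with map_smul' := fun c m => map_smul h (algebraMap k R c) m }
  let φ : M →ₗ[k] k :=
    { toFun := fun m => d.form m n
      map_add' := fun x y => by simp
      map_smul' := fun c m => d.smul_left c m n }
  obtain ⟨r, hr⟩ := hk.exists_leftInverse_of_injective (LinearMap.ker_eq_bot.2 hi)
  obtain ⟨n', hn'⟩ := d'.exists_form_eq hB (φ.comp r).toAddMonoidHom
    fun c m => (φ.comp r).map_smul c m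
  refine ⟨n', d.ext_right fun m => ?_⟩
  rw [hh, hn']
  exact congr(φ ($hr m))

/-- Transposes of surjective maps are injective. -/
theorem DualPair.injective_of_surjective
    (d : DualPair k R S e M N) (d' : DualPair k R S e M' N')
    {h : M →ₗ[R] M'} {h' : N' →ₗ[S] N} (hh : ∀ m n', d.form m (h' n') = d'.form (h m) n')
    (hs : Function.Surjective h) : Function.Injective h' := by
  refine (injective_iff_map_eq_zero h').2 fun n' hn' => d'.sep_right _ fun m' => ?_
  obtain ⟨m, rfl⟩ := hs m'
  rw [← hh, hn', map_zero]

/-- Transposes of exact sequences `M → M' → M'' → 0` are exact. -/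
theorem DualPair.exact_of_exact [Module.Finite k R] [Module.Finite R M'']
    (hB : IsRegularBimodule k R S e) (d : DualPair k R S e M N) (d' : DualPair k R S e M' N')
    (d'' : DualPair k R S e M'' N'')
    {f : M →ₗ[R] M'} {f' : N' →ₗ[S] N} (hf : ∀ m n', d.form m (f' n') = d'.form (f m) n')
    {g : M' →ₗ[R] M''} {g' : N'' →ₗ[S] N'} (hg : ∀ m n', d'.form m (g' n') = d''.form (g m) n')
    (hfg : Function.Exact f g) (hs : Function.Surjective g) : Function.Exact g' f' := by
  intro n'
  constructor
  · intro hn'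
    have hker : LinearMap.ker g.toAddMonoidHom.toIntLinearMap ≤
        LinearMap.ker (d'.form.flip n').toIntLinearMap := by
      intro m' hm'
      obtain ⟨m, rfl⟩ := (hfg m').1 hm'
      change d'.form (f m) n' = 0
      rw [← hf, hn', map_zero]
    have hwd : ∀ m' m'', g m' = g m'' → d'.form m' n' = d'.form m'' n' := fun x y hxy => by
      have h1 := hker (show x - y ∈ _ by
        change g (x - y) = 0
        rw [map_sub, hxy, sub_self])
      change d'.form (x - y) n' = 0 at h1
      rwa [map_sub, AddMonoidHom.sub_apply, sub_eq_zero] at h1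
    choose σ hσ using hs
    obtain ⟨n'', hn''⟩ := d''.exists_form_eq hB
      { toFun := fun x => d'.form (σ x) n'
        map_zero' := by rw [hwd (σ 0) 0 (by rw [hσ, map_zero])]; simp
        map_add' := fun x y => by
          rw [hwd (σ (x + y)) (σ x + σ y) (by rw [map_add, hσ, hσ, hσ])]; simp }
      fun c x => by
        change d'.form (σ _) n' = c * d'.form (σ x) n'
        rw [← d'.smul_left]
        exact hwd _ _ (by rw [map_smul, hσ, hσ])
    refine ⟨n'', d'.ext_right fun m' => ?_⟩
    rw [hg, hn'']
    exact hwd _ _ (hσ _)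
  · rintro ⟨n'', rfl⟩
    refine d.sep_right _ fun m => ?_
    rw [hf, hg, hfg.apply_apply_eq_zero, map_zero, AddMonoidHom.zero_apply]

/-- Transport of a duality along isomorphisms. -/
def DualPair.congr (d : DualPair k R S e M N) (f : M' ≃ₗ[R] M) (g : N' ≃ₗ[S] N) :
    DualPair k R S e M' N' where
  form := (d.form.comp f.toLinearMap.toAddMonoidHom).compl₂ g.toLinearMap.toAddMonoidHom
  smul_left c m n := by simp [d.smul_left]
  balanced r s h m n := by simp [d.balanced r s h]
  sep_left m h := f.map_eq_zero_iff.1 <| d.sep_left _ fun n => by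
    simpa using h (g.symm n)
  sep_right n h := g.map_eq_zero_iff.1 <| d.sep_right _ fun m => by
    simpa using h (f.symm m)

theorem StdDual.eq_zero_of_forall {M : Type u} [AddCommGroup M] [Module R M] {m : M}
    (h : ∀ φ : StdDual k R M,
      (show Module.Dual k (RestrictScalars k R M) from φ) (show RestrictScalars k R M from m) = 0) :
    m = 0 := by
  let : Module k M := Module.compHom M (algebraMap k R)
  exact (Module.forall_dual_apply_eq_zero_iff k m).1 fun φ => h φ

/-- The evaluation pairing of a module with its standard dual. -/
def StdDual.form (k R M : Type u) [Field k] [Ring R] [Algebra k R] [AddCommGroup M] [Module R M] :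
    M →+ StdDual k R M →+ k :=
  AddMonoidHom.flip
    { toFun := fun φ => (show Module.Dual k (RestrictScalars k R M) from φ).toAddMonoidHom
      map_zero' := rfl
      map_add' := fun _ _ => rfl }

/-- Every module has a dual. -/
theorem exists_dualPair (hB : IsRegularBimodule k R S e) [SMulCommClass R S B] (M : Type u)
    [AddCommGroup M] [Module R M] :
    ∃ N : ModuleCat.{u} S, Nonempty (DualPair k R S e M N) := by
  choose ρ hρ using fun s : S => hB.bijective_left.2 (s • e)
  have hinj := hB.bijective_left.1
  let σ : S →+* Rᵐᵒᵖ :=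
    { toFun := fun s => MulOpposite.op (ρ s)
      map_one' := MulOpposite.unop_injective <| hinj <| by simp [hρ]
      map_mul' := fun s t => MulOpposite.unop_injective <| hinj <| by
        simp only [MulOpposite.unop_op, MulOpposite.unop_mul] at hρ ⊢
        rw [hρ, mul_smul, mul_smul, hρ, ← hρ t, ← smul_comm]
      map_zero' := MulOpposite.unop_injective <| hinj <| by simp [hρ]
      map_add' := fun s t => MulOpposite.unop_injective <| hinj <| by
        simp only [MulOpposite.unop_op, MulOpposite.unop_add] at hρ ⊢
        rw [hρ, add_smul, add_smul, hρ, hρ] }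
  let : Module S (StdDual k R M) := Module.compHom _ σ
  refine ⟨ModuleCat.of S (StdDual k R M), ⟨?_⟩⟩
  exact
    { form := StdDual.form k R M
      smul_left := fun c m n =>
        (show Module.Dual k (RestrictScalars k R M) from n).map_smul c m
      balanced := fun r s h m n => by
        have : r = ρ s := hinj (h.trans (hρ s).symm)
        subst this
        rfl
      sep_left := fun m h => StdDual.eq_zero_of_forall h
      sep_right := fun n h => LinearMap.ext h }

/-- The pairing of a left module with its standard dual. -/
def stdDualPairLeft (k A : Type u) [Field k] [Ring A] [Algebra k A] (M : Type u) [AddCommGroup M]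
    [Module A M] : DualPair k A Aᵐᵒᵖ (1 : A) M (StdDual k A M) where
  form := StdDual.form k A M
  smul_left c m n :=
    (show Module.Dual k (RestrictScalars k A M) from n).map_smul c m
  balanced r s h m n := by
    have : r = s.unop := by simpa [MulOpposite.smul_eq_mul_unop] using h
    subst this
    rfl
  sep_left m h := StdDual.eq_zero_of_forall h
  sep_right n h := LinearMap.ext h

/-- The pairing of a right module with its standard dual. -/
def stdDualPairRight (k A : Type u) [Field k] [Ring A] [Algebra k A] (M : Type u) [AddCommGroup M]
    [Module Aᵐᵒᵖ M] : DualPair k Aᵐᵒᵖ A (1 : A) M (StdDual k Aᵐᵒᵖ M) where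
  form := StdDual.form k Aᵐᵒᵖ M
  smul_left c m n :=
    (show Module.Dual k (RestrictScalars k Aᵐᵒᵖ M) from n).map_smul c m
  balanced r s h m n := by
    have : r = MulOpposite.op s := by
      apply MulOpposite.unop_injective
      simpa [MulOpposite.smul_eq_mul_unop] using h
    subst this
    rfl
  sep_left m h := StdDual.eq_zero_of_forall h
  sep_right n h := LinearMap.ext h

end

/-! ### Duality exchanges projective and injective modules -/

section

variable {k R S B : Type u} [Field k] [Ring R] [Ring S] [Algebra k R] [Algebra k S]
  [AddCommGroup B] [Module R B] [Module S B] [SMulCommClass R S B] [SMulCommClass S R B] {e : B}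
  [Module.Finite k R] [Module.Finite k S]
  {M N : Type u} [AddCommGroup M] [Module R M] [AddCommGroup N] [Module S N]

/-- The dual of a projective module is injective. -/
theorem DualPair.injective_of_projective (hB : IsRegularBimodule k R S e)
    (d : DualPair k R S e M N) [Module.Finite R M] [Module.Projective R M] :
    Module.Injective S N := by
  have := IsNoetherianRing.of_finite k S
  have := IsNoetherianRing.of_finite k R
  refine Module.Baer.injective fun I g => ?_
  obtain ⟨MI, ⟨dI⟩⟩ := exists_dualPair hB.symm I
  obtain ⟨MS, ⟨dS⟩⟩ := exists_dualPair hB.symm S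
  have := dS.finite_right hB.symm
  obtain ⟨g', hg'⟩ := dI.exists_transpose hB.symm (d.symm hB) g
  obtain ⟨i', hi'⟩ := dI.exists_transpose hB.symm dS I.subtype
  obtain ⟨l, hl⟩ := Module.projective_lifting_property i' g'
    (dI.surjective_of_injective hB.symm dS hi' I.injective_subtype)
  obtain ⟨l', hl'⟩ := d.exists_transpose hB (dS.symm hB.symm) l
  refine ⟨l', fun x hx => d.ext_right fun m => ?_⟩
  rw [hl', DualPair.symm_form]
  have := hi' ⟨x, hx⟩ (l m)
  rw [← LinearMap.comp_apply i' l, hl, hg'] at this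
  exact this.symm

/-- The dual of an injective module is projective. -/
theorem DualPair.projective_of_injective (hB : IsRegularBimodule k R S e)
    (d : DualPair k R S e M N) [Module.Finite R M] [hI : Module.Injective R M] :
    Module.Projective S N := by
  have := d.finite_right hB
  obtain ⟨n, p, hp⟩ := Module.Finite.exists_fin' S N
  obtain ⟨MF, ⟨dF⟩⟩ := exists_dualPair hB.symm (Fin n → S)
  have := dF.finite_right hB.symm
  obtain ⟨p', hp'⟩ := dF.exists_transpose hB.symm (d.symm hB) p
  have hp'i := dF.injective_of_surjective (d.symm hB) hp' hp
  obtain ⟨r, hr⟩ := hI.out p' hp'i LinearMap.id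
  obtain ⟨r', hr'⟩ := (dF.symm hB.symm).exists_transpose hB d r
  refine Module.Projective.of_split r' p (LinearMap.ext fun x => d.ext_right fun m => ?_)
  have h1 := hp' (r' x) m
  have h2 := hr' (p' m) x
  rw [hr] at h2
  simp only [DualPair.symm_form] at h1 h2
  exact h1.symm.trans h2

end

/-! ### The duality `Hom(-, B)` on finitely generated projective modules -/

section

variable {k R S B : Type u} [Field k] [Ring R] [Ring S] [Algebra k R] [Algebra k S]
  [AddCommGroup B] [Module R B] [Module S B] [SMulCommClass R S B] [SMulCommClass S R B] {e : B}

/-- A regular bimodule is free of rank one. -/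
noncomputable def IsRegularBimodule.equiv (hB : IsRegularBimodule k R S e) : R ≃ₗ[R] B :=
  LinearEquiv.ofBijective (LinearMap.toSpanSingleton R B e) hB.bijective_left

@[simp]
theorem IsRegularBimodule.equiv_apply (hB : IsRegularBimodule k R S e) (r : R) :
    hB.equiv r = r • e := rfl

@[simp]
theorem IsRegularBimodule.equiv_symm_smul (hB : IsRegularBimodule k R S e) (b : B) :
    hB.equiv.symm b • e = b := hB.equiv.apply_symm_apply b

variable {P : Type u} [AddCommGroup P] [Module R P]

/-- Every finitely generated projective module has a dual basis. -/
theorem exists_dualBasis [Module.Finite R P] [Module.Projective R P]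
    (hB : IsRegularBimodule k R S e) :
    ∃ (n : ℕ) (x : Fin n → P) (φ : Fin n → P →ₗ[R] B),
      ∀ p, ∑ i, hB.equiv.symm (φ i p) • x i = p := by
  obtain ⟨n, f, hf⟩ := Module.Finite.exists_fin' R P
  obtain ⟨s, hs⟩ := Module.projective_lifting_property f LinearMap.id hf
  refine ⟨n, fun i => f (Pi.single i 1),
    fun i => hB.equiv.toLinearMap ∘ₗ LinearMap.proj i ∘ₗ s, fun p => ?_⟩
  simp only [LinearMap.comp_apply, LinearEquiv.coe_coe, LinearEquiv.symm_apply_apply,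
    LinearMap.proj_apply]
  have h : f (s p) = p := congr($hs p)
  conv_rhs => rw [← h, ← LinearMap.sum_single_apply (φ := fun _ => R) (v := s p)]
  rw [map_sum]
  refine Finset.sum_congr rfl fun i _ => ?_
  rw [← map_smul, ← Pi.single_smul, smul_eq_mul, mul_one]

/-- Any functional is determined by its values on a dual basis. -/
theorem sum_dualBasis_smul (hB : IsRegularBimodule k R S e) {n : ℕ} {x : Fin n → P}
    {φ : Fin n → P →ₗ[R] B} (h : ∀ p, ∑ i, hB.equiv.symm (φ i p) • x i = p) (ψ : P →ₗ[R] B) :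
    ∑ i, hB.symm.equiv.symm (ψ (x i)) • φ i = ψ := by
  ext p
  conv_rhs => rw [← h p]
  rw [LinearMap.sum_apply, map_sum]
  refine Finset.sum_congr rfl fun i _ => ?_
  rw [LinearMap.smul_apply, map_smul]
  conv_rhs => rw [← hB.symm.equiv_symm_smul (ψ (x i)), smul_comm, hB.equiv_symm_smul]

theorem finite_projective_dual [Module.Finite R P] [Module.Projective R P]
    (hB : IsRegularBimodule k R S e) :
    Module.Finite S (P →ₗ[R] B) ∧ Module.Projective S (P →ₗ[R] B) := by
  obtain ⟨n, x, φ, h⟩ := exists_dualBasis (P := P) hB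
  let f : (Fin n → S) →ₗ[S] (P →ₗ[R] B) := Fintype.linearCombination S φ
  let g : (P →ₗ[R] B) →ₗ[S] (Fin n → S) := LinearMap.pi fun i =>
    hB.symm.equiv.symm.toLinearMap ∘ₗ LinearMap.applyₗ' S (x i)
  have hfg : f ∘ₗ g = LinearMap.id := LinearMap.ext fun ψ => sum_dualBasis_smul hB h ψ
  exact ⟨Module.Finite.of_surjective f fun ψ => ⟨g ψ, congr($hfg ψ)⟩,
    Module.Projective.of_split g f hfg⟩

variable (R S B P) in
/-- The evaluation map from `P` to its double dual. -/
def evalDual : P →ₗ[R] ((P →ₗ[R] B) →ₗ[S] B) where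
  toFun p := LinearMap.applyₗ' S p
  map_add' p q := by ext; simp
  map_smul' r p := by ext; simp

@[simp]
theorem evalDual_apply (p : P) (ψ : P →ₗ[R] B) : evalDual R S B P p ψ = ψ p := rfl

/-- Finitely generated projective modules are reflexive. -/
theorem bijective_evalDual [Module.Finite R P] [Module.Projective R P]
    (hB : IsRegularBimodule k R S e) : Function.Bijective (evalDual R S B P) := by
  obtain ⟨n, x, φ, h⟩ := exists_dualBasis (P := P) hB
  constructor
  · refine (injective_iff_map_eq_zero _).2 fun p hp => ?_
    rw [← h p]
    refine Finset.sum_eq_zero fun i _ => ?_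
    rw [← evalDual_apply (R := R) (S := S) p (φ i), hp, LinearMap.zero_apply, map_zero, zero_smul]
  · intro Φ
    refine ⟨∑ i, hB.equiv.symm (Φ (φ i)) • x i, LinearMap.ext fun ψ => ?_⟩
    conv_rhs => rw [← sum_dualBasis_smul hB h ψ]
    rw [evalDual_apply, map_sum, map_sum]
    refine Finset.sum_congr rfl fun i _ => ?_
    rw [map_smul, map_smul]
    conv_lhs => rw [← hB.symm.equiv_symm_smul (ψ (x i)), smul_comm, hB.equiv_symm_smul]

/-- The natural evaluation equivalence of a finitely generated projective module with its double
dual. -/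
noncomputable def evalDualEquiv [Module.Finite R P] [Module.Projective R P]
    (hB : IsRegularBimodule k R S e) : P ≃ₗ[R] ((P →ₗ[R] B) →ₗ[S] B) :=
  LinearEquiv.ofBijective _ (bijective_evalDual hB)

/-- Every map between the duals of finitely generated projective modules is induced. -/
theorem exists_eq_lcomp [Module.Finite R P] [Module.Projective R P]
    (hB : IsRegularBimodule k R S e) {Q : Type u} [AddCommGroup Q] [Module R Q]
    (a : (P →ₗ[R] B) →ₗ[S] (Q →ₗ[R] B)) :
    ∃ α : Q →ₗ[R] P, ∀ φ, a φ = φ ∘ₗ α := by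
  let a' : Q →ₗ[R] ((P →ₗ[R] B) →ₗ[S] B) :=
    { toFun := fun q => evalDual R S B Q q ∘ₗ a
      map_add' := fun p q => by ext; simp
      map_smul' := fun r q => by ext; simp }
  refine ⟨(evalDualEquiv hB).symm.toLinearMap ∘ₗ a', fun φ => LinearMap.ext fun q => ?_⟩
  have h := (evalDualEquiv hB).apply_symm_apply (a' q)
  have h' := congr($h φ)
  exact h'.symm

/-- The bimodule `B` separates maps into a finitely generated projective module. -/
theorem eq_of_forall_comp_eq [Module.Finite R P] [Module.Projective R P]
    (hB : IsRegularBimodule k R S e) {Q : Type u} [AddCommGroup Q] [Module R Q]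
    {f g : Q →ₗ[R] P} (h : ∀ φ : P →ₗ[R] B, φ ∘ₗ f = φ ∘ₗ g) : f = g :=
  LinearMap.ext fun q => (bijective_evalDual (S := S) hB).1 <|
    LinearMap.ext fun φ => congr($(h φ) q)

/-! ### The trace pairing between `Hom(P*, W)` and `Hom(P, D W)` -/

variable {N W : Type u} [AddCommGroup N] [Module R N] [AddCommGroup W] [Module S W]

/-- The map `p ↦ φ(p) n`, for `φ : P → B` and `n ∈ N`, where `B` is identified with `R`. -/
noncomputable def rankOne (hB : IsRegularBimodule k R S e) (φ : P →ₗ[R] B) (n : N) : P →ₗ[R] N :=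
  LinearMap.toSpanSingleton R N n ∘ₗ hB.equiv.symm.toLinearMap ∘ₗ φ

theorem rankOne_apply (hB : IsRegularBimodule k R S e) (φ : P →ₗ[R] B) (n : N) (p : P) :
    rankOne hB φ n p = hB.equiv.symm (φ p) • n := rfl

theorem rankOne_comp (hB : IsRegularBimodule k R S e) {Q : Type u} [AddCommGroup Q] [Module R Q]
    (φ : P →ₗ[R] B) (n : N) (f : Q →ₗ[R] P) :
    rankOne hB φ n ∘ₗ f = rankOne hB (φ ∘ₗ f) n := rfl

theorem comp_rankOne (hB : IsRegularBimodule k R S e) {N' : Type u} [AddCommGroup N'] [Module R N']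
    (φ : P →ₗ[R] B) (n : N) (g : N →ₗ[R] N') :
    g ∘ₗ rankOne hB φ n = rankOne hB φ (g n) := by
  ext p; simp [rankOne_apply]

variable [Module k N] [IsScalarTower k R N]

/-- Maps `t : P* → W` correspond to functionals `ξ` on `Hom(P, N)`, where `N` is dual to `W`: the
functional determines the map by `⟨n, t φ⟩ = ξ (φ(-) n)`. -/
theorem DualPair.exists_hom_of_functional [Module.Finite k R] [Module.Finite R N]
    (hB : IsRegularBimodule k R S e) (d : DualPair k R S e N W) (ξ : (P →ₗ[R] N) →ₗ[k] k) :
    ∃ t : (P →ₗ[R] B) →ₗ[S] W, ∀ φ n, d.form n (t φ) = ξ (rankOne hB φ n) := by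
  have key : ∀ φ : P →ₗ[R] B, ∃ w, ∀ n, d.form n w = ξ (rankOne hB φ n) := fun φ =>
    d.exists_form_eq hB
      { toFun := fun n => ξ (rankOne hB φ n)
        map_zero' := by
          rw [← map_zero ξ]; congr 1; ext p; simp [rankOne_apply]
        map_add' := fun m n => by
          rw [← map_add]; congr 1; ext p; simp [rankOne_apply] }
      fun c n => by
        change ξ _ = c * ξ _
        rw [← smul_eq_mul, ← map_smul]; congr 1; ext p
        rw [rankOne_apply, algebraMap_smul, LinearMap.smul_apply, rankOne_apply, smul_comm]
  choose t ht using key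
  refine ⟨{ toFun := t, map_add' := fun φ ψ => d.ext_right fun n => ?_,
            map_smul' := fun s φ => d.ext_right fun n => ?_ }, ht⟩
  · rw [map_add, ht, ht, ht, ← map_add]; congr 1; ext p; simp [rankOne_apply, add_smul]
  · obtain ⟨r, hr⟩ := hB.bijective_left.2 (s • e)
    rw [RingHom.id_apply, ← d.balanced r s hr, ht, ht]; congr 1; ext p
    rw [rankOne_apply, rankOne_apply, ← mul_smul]; congr 1
    apply hB.equiv.injective
    simp only [hB.equiv_apply, LinearMap.smul_apply, mul_smul] at hr ⊢
    rw [hr, hB.equiv_symm_smul, smul_comm, hB.equiv_symm_smul]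

/-- The functional attached to a map `t : P* → W`. -/
theorem DualPair.exists_functional_of_hom [Module.Finite R P] [Module.Projective R P]
    (hB : IsRegularBimodule k R S e) (d : DualPair k R S e N W) (t : (P →ₗ[R] B) →ₗ[S] W) :
    ∃ ξ : (P →ₗ[R] N) →ₗ[k] k, ∀ φ n, d.form n (t φ) = ξ (rankOne hB φ n) := by
  obtain ⟨n, x, φ, h⟩ := exists_dualBasis (P := P) hB
  refine ⟨{ toFun := fun c => ∑ i, d.form (c (x i)) (t (φ i)), map_add' := fun c c' => ?_,
            map_smul' := fun a c => ?_ }, fun ψ n => ?_⟩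
  · simp [Finset.sum_add_distrib]
  · simp [Finset.mul_sum, ← d.smul_left]
  · change _ = ∑ i, d.form (rankOne hB ψ n (x i)) (t (φ i))
    conv_lhs => rw [← sum_dualBasis_smul hB h ψ]
    rw [map_sum, map_sum]
    refine Finset.sum_congr rfl fun i _ => ?_
    rw [map_smul, rankOne_apply]
    refine (d.balanced _ _ ?_ _ _).symm
    rw [hB.equiv_symm_smul, hB.symm.equiv_symm_smul]

/-- The maps of rank one span `Hom(P, N)`. -/
theorem functional_ext [Module.Finite R P] [Module.Projective R P]
    (hB : IsRegularBimodule k R S e) {ξ ξ' : (P →ₗ[R] N) →ₗ[k] k}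
    (h : ∀ φ n, ξ (rankOne hB φ n) = ξ' (rankOne hB φ n)) : ξ = ξ' := by
  obtain ⟨n, x, φ, hx⟩ := exists_dualBasis (P := P) hB
  refine LinearMap.ext fun c => ?_
  have : c = ∑ i, rankOne hB (φ i) (c (x i)) := LinearMap.ext fun p => by
    conv_lhs => rw [← hx p]
    simp [rankOne_apply]
  rw [this, map_sum, map_sum]
  exact Finset.sum_congr rfl fun i _ => h _ _

/-- A map `t : P₀* → W` extends along `P₀* → P₁*` as soon as the functional attached to it vanishes
on all maps `P₀ → N` which vanish on `P₁`. -/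
theorem DualPair.exists_extension [Module.Finite k R] [Module.Finite R N]
    (hB : IsRegularBimodule k R S e) (d : DualPair k R S e N W)
    {Q : Type u} [AddCommGroup Q] [Module R Q] (f : Q →ₗ[R] P)
    {t : (P →ₗ[R] B) →ₗ[S] W} {ξ : (P →ₗ[R] N) →ₗ[k] k}
    (ht : ∀ φ n, d.form n (t φ) = ξ (rankOne hB φ n)) (hξ : ∀ c, c ∘ₗ f = 0 → ξ c = 0) :
    ∃ w : (Q →ₗ[R] B) →ₗ[S] W, ∀ φ, w (φ ∘ₗ f) = t φ := by
  let F : (P →ₗ[R] N) →ₗ[k] (Q →ₗ[R] N) := LinearMap.lcomp k N f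
  obtain ⟨η, hη⟩ : ∃ η : (Q →ₗ[R] N) →ₗ[k] k, η ∘ₗ F = ξ := by
    let ξ' := (LinearMap.ker F).liftQ ξ fun c hc => hξ c hc
    let F' := (LinearMap.ker F).liftQ F le_rfl
    obtain ⟨g, hg⟩ := F'.exists_leftInverse_of_injective (Submodule.ker_liftQ_eq_bot' _ _ rfl)
    refine ⟨ξ' ∘ₗ g, LinearMap.ext fun c => ?_⟩
    exact congr(ξ' ($hg ((LinearMap.ker F).mkQ c)))
  obtain ⟨w, hw⟩ := d.exists_hom_of_functional hB η
  refine ⟨w, fun φ => d.ext_right fun n => ?_⟩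
  rw [hw, ht, ← hη, ← rankOne_comp]
  rfl

end

/-! ### Fitting's lemma, projective covers and injective hulls -/

section

/-- A retract of an injective module is injective. -/
theorem injective_of_retract {R : Type u} [Ring R] {I E : Type u} [AddCommGroup I] [Module R I]
    [AddCommGroup E] [Module R E] [hE : Module.Injective R E] (i : I →ₗ[R] E) (r : E →ₗ[R] I)
    (h : ∀ x, r (i x) = x) : Module.Injective R I where
  out X Y _ _ _ _ f hf g := by
    obtain ⟨l, hl⟩ := hE.out f hf (i ∘ₗ g)
    exact ⟨r ∘ₗ l, fun x => by simp [hl, h]⟩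

variable {R : Type u} [Ring R] [IsArtinianRing R] [IsNoetherianRing R]

theorem exists_pos_isCompl_ker_range {M : Type u} [AddCommGroup M] [Module R M] [Module.Finite R M]
    (φ : Module.End R M) :
    ∃ n : ℕ, 1 ≤ n ∧ IsCompl (LinearMap.ker (φ ^ n)) (LinearMap.range (φ ^ n)) := by
  obtain ⟨n, h, hn⟩ := (φ.eventually_isCompl_ker_pow_range_pow.and
    (Filter.eventually_ge_atTop 1)).exists
  exact ⟨n, hn, h⟩

/-- Fitting's lemma: an endomorphism of an indecomposable module of finite length is nilpotent or
bijective. -/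
theorem isNilpotent_or_bijective_of_indecomposable {M : ModuleCat.{u} R} [Module.Finite R M]
    (hM : CategoryTheory.Indecomposable M) (φ : Module.End R M) :
    IsNilpotent φ ∨ Function.Bijective φ := by
  obtain ⟨n, hn, h⟩ := exists_pos_isCompl_ker_range φ
  let i : M ≅ CategoryTheory.Limits.biprod (ModuleCat.of R (LinearMap.ker (φ ^ n)))
      (ModuleCat.of R (LinearMap.range (φ ^ n))) :=
    (Submodule.prodEquivOfIsCompl _ _ h).symm.toModuleIso ≪≫
      (ModuleCat.biprodIsoProd (ModuleCat.of R (LinearMap.ker (φ ^ n)))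
        (ModuleCat.of R (LinearMap.range (φ ^ n)))).symm
  rcases hM.2 _ _ i with h0 | h0
  · right
    have h1 := ModuleCat.subsingleton_of_isZero h0
    have h2 : LinearMap.ker (φ ^ n) = ⊥ := Submodule.subsingleton_iff_eq_bot.1 h1
    refine IsArtinian.bijective_of_injective_endomorphism φ (LinearMap.ker_eq_bot.1 ?_)
    rw [eq_bot_iff, ← h2]
    obtain ⟨m, rfl⟩ := Nat.exists_eq_succ_of_ne_zero (by omega : n ≠ 0)
    intro x hx
    rw [LinearMap.mem_ker] at hx ⊢
    rw [Nat.succ_eq_add_one, pow_succ, Module.End.mul_apply, hx, map_zero]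
  · left
    have h1 := ModuleCat.subsingleton_of_isZero h0
    have h2 : LinearMap.range (φ ^ n) = ⊥ := Submodule.subsingleton_iff_eq_bot.1 h1
    exact ⟨n, LinearMap.range_eq_bot.1 h2⟩

/-- A complemented submodule is a retract. -/
theorem exists_retraction_range {M : Type u} [AddCommGroup M] [Module R M] {p q : Submodule R M}
    (h : IsCompl p q) : ∃ r : M →ₗ[R] q, ∀ x : q, r x = x :=
  ⟨Submodule.projectionOnto q p h.symm, Submodule.projectionOnto_apply_left h.symm⟩

/-- A surjection from a finitely generated projective module which has the least possible length
is a projective cover. -/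
theorem exists_projectiveCover (M : Type u) [AddCommGroup M] [Module R M] [Module.Finite R M] :
    ∃ (P : ModuleCat.{u} R) (p : P →ₗ[R] M), Module.Finite R P ∧ Module.Projective R P ∧
      Function.Surjective p ∧ IsSuperfluous (LinearMap.ker p) := by
  suffices key : ∀ (l : ℕ∞) (P : ModuleCat.{u} R) (p : P →ₗ[R] M), Module.length R P = l →
      Module.Finite R P → Module.Projective R P → Function.Surjective p →
      ∃ (P : ModuleCat.{u} R) (p : P →ₗ[R] M), Module.Finite R P ∧ Module.Projective R P ∧
        Function.Surjective p ∧ IsSuperfluous (LinearMap.ker p) by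
    obtain ⟨n, f, hf⟩ := Module.Finite.exists_fin' R M
    exact key _ (ModuleCat.of R (Fin n → R)) f rfl inferInstance inferInstance hf
  intro l
  induction l using WellFoundedLT.induction with
  | ind l ih =>
    intro P p hl hfin hproj hp
    by_cases hs : IsSuperfluous (LinearMap.ker p)
    · exact ⟨P, p, hfin, hproj, hp, hs⟩
    simp only [IsSuperfluous, not_forall] at hs
    obtain ⟨K, hK, hK'⟩ := hs
    have hKs : Function.Surjective (p ∘ₗ K.subtype) := by
      rw [← LinearMap.range_eq_top, LinearMap.range_comp, Submodule.range_subtype]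
      have h1 := congr(Submodule.map p $hK)
      rwa [Submodule.map_sup, LinearMap.le_ker_iff_map.1 le_rfl, bot_sup_eq, Submodule.map_top,
        LinearMap.range_eq_top.2 hp] at h1
    obtain ⟨t, ht⟩ := Module.projective_lifting_property _ p hKs
    let φ : Module.End R P := K.subtype ∘ₗ t
    have hφ : ∀ n x, p ((φ ^ n) x) = p x := by
      intro n
      induction n with
      | zero => simp
      | succ n ihn => exact fun x => by rw [pow_succ, Module.End.mul_apply, ihn]; exact congr($ht x)
    obtain ⟨n, hn, h⟩ := exists_pos_isCompl_ker_range φ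
    obtain ⟨r, hr⟩ := exists_retraction_range h
    refine ih _ ?_ (ModuleCat.of R (LinearMap.range (φ ^ n)))
      (p ∘ₗ (LinearMap.range (φ ^ n)).subtype) rfl (inferInstanceAs (Module.Finite R
        (LinearMap.range (φ ^ n)))) (Module.Projective.of_split
        (LinearMap.range (φ ^ n)).subtype r (LinearMap.ext hr)) ?_
    · rw [← hl]
      refine Submodule.length_lt fun htop => hK' (top_le_iff.1 (htop ▸ ?_))
      obtain ⟨m, rfl⟩ := Nat.exists_eq_succ_of_ne_zero (by omega : n ≠ 0)
      rintro _ ⟨x, rfl⟩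
      rw [Nat.succ_eq_add_one, pow_succ', Module.End.mul_apply]
      exact (t _).2
    · intro m
      obtain ⟨x, rfl⟩ := hp m
      exact ⟨⟨_, x, rfl⟩, hφ n x⟩

theorem exists_isMinimalProjectivePresentation (M : Type u) [AddCommGroup M] [Module R M]
    [Module.Finite R M] : ∃ (P₁ P₀ : ModuleCat.{u} R) (f : P₁ →ₗ[R] P₀) (p : P₀ →ₗ[R] M),
      IsMinimalProjectivePresentation f p := by
  obtain ⟨P₀, p, h1, h2, h3, h4⟩ := exists_projectiveCover (R := R) M
  obtain ⟨P₁, q, k1, k2, k3, k4⟩ := exists_projectiveCover (R := R) (LinearMap.ker p)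
  refine ⟨P₁, P₀, (LinearMap.ker p).subtype ∘ₗ q, p, k1, h1, k2, h2, ?_, h3, h4, ?_⟩
  · rw [LinearMap.exact_iff, LinearMap.range_comp, LinearMap.range_eq_top.2 k3, Submodule.map_top,
      Submodule.range_subtype]
  · rwa [LinearMap.ker_comp, Submodule.ker_subtype, Submodule.comap_bot]

/-- Inside a finitely generated injective module, a direct summand of least length which contains
the submodule `M` is an injective hull of `M`. -/
theorem exists_injectiveHull {M : Type u} [AddCommGroup M] [Module R M] {E : Type u}
    [AddCommGroup E] [Module R E] (hfin : Module.Finite R E) (hinj : Module.Injective R E)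
    {ι : M →ₗ[R] E} (hι : Function.Injective ι) :
    ∃ (I : ModuleCat.{u} R) (j : M →ₗ[R] I) (i : I →ₗ[R] E) (r : E →ₗ[R] I), Module.Finite R I ∧
      Module.Injective R I ∧ Function.Injective j ∧ IsEssential (LinearMap.range j) ∧
      r ∘ₗ i = LinearMap.id := by
  suffices key : ∀ (l : ℕ∞) (E : ModuleCat.{u} R) (ι : M →ₗ[R] E), Module.length R E = l →
      Module.Finite R E → Module.Injective R E → Function.Injective ι →
      ∃ (I : ModuleCat.{u} R) (j : M →ₗ[R] I) (i : I →ₗ[R] E) (r : E →ₗ[R] I),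
        Module.Finite R I ∧ Module.Injective R I ∧ Function.Injective j ∧
        IsEssential (LinearMap.range j) ∧ r ∘ₗ i = LinearMap.id from
    key _ (ModuleCat.of R E) ι rfl hfin hinj hι
  intro l
  induction l using WellFoundedLT.induction with
  | ind l ih =>
    intro E ι hl hfin hinj hι
    by_cases hs : IsEssential (LinearMap.range ι)
    · exact ⟨E, ι, LinearMap.id, LinearMap.id, hfin, hinj, hι, hs, rfl⟩
    simp only [IsEssential, not_forall] at hs
    obtain ⟨K, hK, hK'⟩ := hs
    have hKi : Function.Injective (K.mkQ ∘ₗ ι) := by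
      refine (injective_iff_map_eq_zero _).2 fun m hm => ?_
      rw [LinearMap.comp_apply, Submodule.mkQ_apply, Submodule.Quotient.mk_eq_zero] at hm
      have : ι m ∈ LinearMap.range ι ⊓ K := ⟨⟨m, rfl⟩, hm⟩
      rw [hK, Submodule.mem_bot] at this
      exact hι (this.trans (map_zero ι).symm)
    obtain ⟨t, ht⟩ := hinj.out _ hKi ι
    let φ : Module.End R E := t ∘ₗ K.mkQ
    have hφ : ∀ n x, (φ ^ n) (ι x) = ι x := by
      intro n
      induction n with
      | zero => simp
      | succ n ihn =>
        intro x
        rw [pow_succ, Module.End.mul_apply]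
        exact (congr((φ ^ n) $(ht x))).trans (ihn x)
    obtain ⟨n, hn, h⟩ := exists_pos_isCompl_ker_range φ
    obtain ⟨r, hr⟩ := exists_retraction_range h
    have hlt : Module.length R (LinearMap.range (φ ^ n)) < l := by
      rw [← hl]
      refine Submodule.length_lt fun htop => hK' ?_
      have hbot := h.inf_eq_bot
      rw [htop, inf_top_eq] at hbot
      rw [eq_bot_iff, ← hbot]
      obtain ⟨m, rfl⟩ := Nat.exists_eq_succ_of_ne_zero (by omega : n ≠ 0)
      intro x hx
      rw [LinearMap.mem_ker, Nat.succ_eq_add_one, pow_succ, Module.End.mul_apply]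
      have : φ x = 0 := by
        change t (K.mkQ x) = 0
        rw [Submodule.mkQ_apply, (Submodule.Quotient.mk_eq_zero K).2 hx, map_zero]
      rw [this, map_zero]
    obtain ⟨I, j, i', r', h1, h2, h3, h4, h5⟩ := ih (Module.length R (LinearMap.range (φ ^ n))) hlt
      (ModuleCat.of R (LinearMap.range (φ ^ n)))
      (ι.codRestrict _ fun m => ⟨ι m, hφ n m⟩) rfl
      (inferInstanceAs (Module.Finite R (LinearMap.range (φ ^ n))))
      (injective_of_retract (LinearMap.range (φ ^ n)).subtype r hr)
      (fun x y hxy => hι congr(($hxy : E)))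
    refine ⟨I, j, (LinearMap.range (φ ^ n)).subtype ∘ₗ i', r' ∘ₗ r, h1, h2, h3, h4, ?_⟩
    ext x
    change r' (r (i' x : LinearMap.range (φ ^ n))) = x
    rw [hr]
    exact congr($h5 x)

end

section

variable {k R S B : Type u} [Field k] [Ring R] [Ring S] [Algebra k R] [Algebra k S]
  [AddCommGroup B] [Module R B] [Module S B] [SMulCommClass R S B] [SMulCommClass S R B] {e : B}
  [Module.Finite k R] [Module.Finite k S]
  {M N : Type u} [AddCommGroup M] [Module R M] [AddCommGroup N] [Module S N]

/-- Fitting's dichotomy passes to the dual. -/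
theorem DualPair.isNilpotent_or_bijective (hB : IsRegularBimodule k R S e)
    (d : DualPair k R S e M N) [Module.Finite R M] [Module.Finite S N]
    (hN : ∀ φ : Module.End S N, IsNilpotent φ ∨ Function.Bijective φ) (φ : Module.End R M) :
    IsNilpotent φ ∨ Function.Bijective φ := by
  obtain ⟨φ', h⟩ := d.exists_transpose hB d φ
  refine (hN φ').imp ?_ ?_
  · rintro ⟨n, hn⟩
    refine ⟨n, LinearMap.ext fun m => d.ext_left fun x => ?_⟩
    have key : ∀ n m x, d.form m ((φ' ^ n) x) = d.form ((φ ^ n) m) x := by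
      intro n
      induction n with
      | zero => simp
      | succ n ih => intro m x; rw [pow_succ', pow_succ, Module.End.mul_apply, h, ih]; rfl
    rw [← key, hn]
    simp
  · intro hb
    have h' : ∀ x m, (d.symm hB).form x (φ m) = (d.symm hB).form (φ' x) m :=
      fun x m => (h m x).symm
    exact ⟨(d.symm hB).injective_of_surjective (d.symm hB) h' hb.2,
      (d.symm hB).surjective_of_injective hB.symm (d.symm hB) h' hb.1⟩

/-- Every finitely generated module embeds into a finitely generated injective module. -/
theorem exists_embedding_injective (hB : IsRegularBimodule k R S e) (M : Type u) [AddCommGroup M]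
    [Module R M] [Module.Finite R M] : ∃ (E : ModuleCat.{u} R) (ι : M →ₗ[R] E),
      Module.Finite R E ∧ Module.Injective R E ∧ Function.Injective ι := by
  obtain ⟨N, ⟨d⟩⟩ := exists_dualPair hB M
  have := d.finite_right hB
  obtain ⟨n, p, hp⟩ := Module.Finite.exists_fin' S N
  obtain ⟨E, ⟨dE⟩⟩ := exists_dualPair hB.symm (Fin n → S)
  obtain ⟨ι, hι⟩ := dE.exists_transpose hB.symm (d.symm hB) p
  exact ⟨E, ι, dE.finite_right hB.symm, dE.injective_of_projective hB.symm,
    dE.injective_of_surjective (d.symm hB) hι hp⟩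

end

/-! ### Existence of almost split sequences -/

theorem exists_comp_eq_of_ker_le {R M N P : Type*} [Ring R] [AddCommGroup M] [Module R M]
    [AddCommGroup N] [Module R N] [AddCommGroup P] [Module R P] {q : M →ₗ[R] N}
    (hq : Function.Surjective q) (f : M →ₗ[R] P) (h : LinearMap.ker q ≤ LinearMap.ker f) :
    ∃ g : N →ₗ[R] P, g ∘ₗ q = f := by
  refine ⟨(LinearMap.ker q).liftQ f h ∘ₗ (q.quotKerEquivOfSurjective hq).symm.toLinearMap,
    LinearMap.ext fun x => ?_⟩
  have : (q.quotKerEquivOfSurjective hq).symm (q x) = (LinearMap.ker q).mkQ x := by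
    rw [LinearEquiv.symm_apply_eq]; rfl
  simp [this]

/-- A linear map with values in the range of an injective map factors through it. -/
theorem exists_comp_eq_of_range_le {R M N P : Type*} [Ring R] [AddCommGroup M] [Module R M]
    [AddCommGroup N] [Module R N] [AddCommGroup P] [Module R P] {i : M →ₗ[R] N}
    (hi : Function.Injective i) (f : P →ₗ[R] N) (h : ∀ x, f x ∈ LinearMap.range i) :
    ∃ g : P →ₗ[R] M, i ∘ₗ g = f := by
  refine ⟨(LinearEquiv.ofInjective i hi).symm.toLinearMap ∘ₗ f.codRestrict _ h,
    LinearMap.ext fun x => ?_⟩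
  have := (LinearEquiv.ofInjective i hi).apply_symm_apply (f.codRestrict _ h x)
  exact congr(($this : N))

section

variable {R : Type u} [Ring R] [IsArtinianRing R] [IsNoetherianRing R]

/-- If the endomorphisms of the right hand term are nilpotent or bijective, then an exact sequence
which is left almost split is almost split. For a map `h : W → V` which does not lift, the
inclusion of `U` in the pullback extends to `X`, and this induces an endomorphism of `V` factoring
through `h`; it is bijective, so that `h` splits, because otherwise the sequence would split. -/
theorem isAlmostSplit_of_left {U X V : ModuleCat.{u} R} [Module.Finite R U] [Module.Finite R X]
    [Module.Finite R V] {f : U →ₗ[R] X} {g : X →ₗ[R] V} (hf : Function.Injective f)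
    (hfg : Function.Exact f g) (hg : Function.Surjective g)
    (hns : ¬ ∃ r : X →ₗ[R] U, r ∘ₗ f = LinearMap.id)
    (hl : ∀ (W : ModuleCat.{u} R) (h : U →ₗ[R] W), Module.Finite R W →
      (¬ ∃ r : W →ₗ[R] U, r ∘ₗ h = LinearMap.id) → ∃ h' : X →ₗ[R] W, h' ∘ₗ f = h)
    (hV : ∀ ψ : Module.End R V, IsNilpotent ψ ∨ Function.Bijective ψ) : IsAlmostSplit f g where
  finite_left := inferInstance
  finite_middle := inferInstance
  finite_right := inferInstance
  injective := hf
  exact := hfg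
  surjective := hg
  not_split_mono := hns
  left_almost_split := hl
  not_split_epi := by
    rintro ⟨s, hs⟩
    obtain ⟨r, hr⟩ := exists_comp_eq_of_range_le hf (LinearMap.id - s ∘ₗ g) fun x => by
      refine (hfg _).1 ?_
      have : g (s (g x)) = g x := congr($hs (g x))
      simp [this]
    refine hns ⟨r, LinearMap.ext fun u => hf ?_⟩
    have := congr($hr (f u))
    simpa [hfg.apply_apply_eq_zero] using this
  right_almost_split W h hW hh := by
    let Y : Submodule R (X × W) :=
      LinearMap.ker (g ∘ₗ LinearMap.fst R X W - h ∘ₗ LinearMap.snd R X W)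
    have hY : ∀ y : Y, g y.1.1 = h y.1.2 := fun y =>
      sub_eq_zero.1 (LinearMap.mem_ker.1 y.2)
    let a : U →ₗ[R] Y := ((LinearMap.inl R X W) ∘ₗ f).codRestrict Y fun u => by
      simp [Y, hfg.apply_apply_eq_zero]
    let q : Y →ₗ[R] W := LinearMap.snd R X W ∘ₗ Y.subtype
    -- If `U` splits off the pullback `Y`, then `W` is a direct summand of `Y`, and `h` lifts.
    by_cases ha : ∃ r : Y →ₗ[R] U, r ∘ₗ a = LinearMap.id
    · obtain ⟨r, hr⟩ := ha
      have hq : Function.Surjective q := fun w => by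
        obtain ⟨x, hx⟩ := hg (h w)
        exact ⟨⟨(x, w), by simp [Y, hx]⟩, rfl⟩
      obtain ⟨σ, hσ⟩ := exists_comp_eq_of_ker_le hq (LinearMap.id - a ∘ₗ r) fun y hy => by
        have hy' : y.1.2 = 0 := hy
        obtain ⟨u, hu⟩ := (hfg _).1 ((hY y).trans (by rw [hy', map_zero]))
        have : y = a u := Subtype.ext (Prod.ext hu.symm hy')
        have hru : r (a u) = u := congr($hr u)
        simp [this, hru]
      refine ⟨LinearMap.fst R X W ∘ₗ Y.subtype ∘ₗ σ, LinearMap.ext fun w => ?_⟩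
      obtain ⟨y, rfl⟩ := hq w
      have h1 : σ (q y) = y - a (r y) := congr($hσ y)
      change g (σ (q y)).1.1 = h (q y)
      rw [hY, h1]
      change h (y.1.2 - 0) = h y.1.2
      rw [sub_zero]
    · obtain ⟨a', ha'⟩ := hl (ModuleCat.of R Y) a (inferInstanceAs (Module.Finite R Y)) ha
      let χ : Module.End R X := LinearMap.fst R X W ∘ₗ Y.subtype ∘ₗ a'
      have hχf : ∀ u, χ (f u) = f u := fun u => congr((($ha' u : Y) : X × W).1)
      obtain ⟨ζ, hζ⟩ := exists_comp_eq_of_ker_le hg (q ∘ₗ a') fun x hx => by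
        obtain ⟨u, rfl⟩ := (hfg x).1 hx
        exact congr((($ha' u : Y) : X × W).2)
      let ψ : Module.End R V := h ∘ₗ ζ
      have hψ : ∀ x, ψ (g x) = g (χ x) := fun x => by
        change h (ζ (g x)) = g (a' x : Y).1.1
        rw [hY]
        exact congr(h ($hζ x))
      rcases hV ψ with ⟨m, hm⟩ | hb
      · exfalso
        have h1 : ∀ m x, (ψ ^ m) (g x) = g ((χ ^ m) x) := fun m => by
          induction m with
          | zero => simp
          | succ m ih => intro x; rw [pow_succ, pow_succ, Module.End.mul_apply, hψ, ih]; rfl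
        have h2 : ∀ m u, (χ ^ m) (f u) = f u := fun m => by
          induction m with
          | zero => simp
          | succ m ih => intro x; rw [pow_succ, Module.End.mul_apply, hχf, ih]
        obtain ⟨r, hr⟩ := exists_comp_eq_of_range_le hf (χ ^ m) fun x => by
          refine (hfg _).1 ?_
          rw [← h1, hm, LinearMap.zero_apply]
        exact hns ⟨r, LinearMap.ext fun u => hf (congr($hr (f u)).trans (h2 m u))⟩
      · exfalso
        let b := LinearEquiv.ofBijective ψ hb
        exact hh ⟨ζ ∘ₗ b.symm.toLinearMap, LinearMap.ext fun v => b.apply_symm_apply v⟩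

/-- Endomorphisms with superfluous range are nilpotent. -/
theorem isNilpotent_of_range_superfluous {M : Type u} [AddCommGroup M] [Module R M]
    [Module.Finite R M] {K : Submodule R M} (hK : IsSuperfluous K) (γ : Module.End R M)
    (hγ : LinearMap.range γ ≤ K) : IsNilpotent γ := by
  obtain ⟨n, hn, h⟩ := exists_pos_isCompl_ker_range γ
  refine ⟨n, LinearMap.ker_eq_top.1 (hK _ (top_le_iff.1 ?_))⟩
  rw [← h.sup_eq_top, sup_comm]
  refine sup_le_sup_right (le_trans ?_ hγ) _
  obtain ⟨m, rfl⟩ := Nat.exists_eq_succ_of_ne_zero (by omega : n ≠ 0)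
  rintro _ ⟨x, rfl⟩
  rw [Nat.succ_eq_add_one, pow_succ', Module.End.mul_apply]
  exact ⟨_, rfl⟩

end

section

variable {k R S B : Type u} [Field k] [Ring R] [Ring S] [Algebra k R] [Algebra k S]
  [AddCommGroup B] [Module R B] [Module S B] [SMulCommClass R S B] [SMulCommClass S R B] {e : B}
  [Module.Finite k R] [Module.Finite k S]

/-- If the endomorphisms of `N` are nilpotent or bijective, then so are the endomorphisms of its
transpose: up to maps which are irrelevant by minimality, both come from endomorphisms of the
minimal projective presentation. -/
theorem isNilpotent_or_bijective_transpose [IsArtinianRing R] [IsNoetherianRing R]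
    [IsNoetherianRing S] (hB : IsRegularBimodule k R S e)
    {P₁ P₀ N : Type u} [AddCommGroup P₁] [Module R P₁] [AddCommGroup P₀] [Module R P₀]
    [AddCommGroup N] [Module R N] {f : P₁ →ₗ[R] P₀} {p : P₀ →ₗ[R] N}
    (hp : IsMinimalProjectivePresentation f p)
    (hN : ∀ φ : Module.End R N, IsNilpotent φ ∨ Function.Bijective φ)
    (ψ : Module.End S ((P₁ →ₗ[R] B) ⧸ LinearMap.range (LinearMap.lcomp S B f))) :
    IsNilpotent ψ ∨ Function.Bijective ψ := by
  have := hp.finite_one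
  have := hp.finite_zero
  have := hp.projective_one
  have := hp.projective_zero
  obtain ⟨hf1, hp1⟩ := finite_projective_dual (P := P₁) hB
  obtain ⟨hf0, hp0⟩ := finite_projective_dual (P := P₀) hB
  let q := (LinearMap.range (LinearMap.lcomp S B f)).mkQ
  have hqs : Function.Surjective q := Submodule.mkQ_surjective _
  -- Lift `ψ` to endomorphisms of `P₁*` and `P₀*`, and write these as duals of `β` and `α`.
  obtain ⟨b', hb'⟩ := Module.projective_lifting_property q (ψ ∘ₗ q) hqs
  obtain ⟨a', ha'⟩ := Module.projective_lifting_property (LinearMap.lcomp S B f).rangeRestrict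
    ((b' ∘ₗ LinearMap.lcomp S B f).codRestrict _ fun φ => by
      rw [← Submodule.ker_mkQ (LinearMap.range (LinearMap.lcomp S B f)), LinearMap.mem_ker]
      have h1 : q (b' (LinearMap.lcomp S B f φ)) = ψ (q (LinearMap.lcomp S B f φ)) :=
        congr($hb' (LinearMap.lcomp S B f φ))
      have h2 : q (LinearMap.lcomp S B f φ) = 0 :=
        (Submodule.Quotient.mk_eq_zero _).2 ⟨φ, rfl⟩
      exact h1.trans (by rw [h2, map_zero])) (LinearMap.surjective_rangeRestrict _)
  obtain ⟨α, hα⟩ := exists_eq_lcomp hB a'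
  obtain ⟨β, hβ⟩ := exists_eq_lcomp hB b'
  have hαβ : α ∘ₗ f = f ∘ₗ β := eq_of_forall_comp_eq hB fun φ => by
    have h1 : a' φ ∘ₗ f = b' (φ ∘ₗ f) := congr((($ha' φ : _) : P₁ →ₗ[R] B))
    rw [hα, hβ] at h1
    exact h1
  have hψq : ∀ φ, ψ (q φ) = q (φ ∘ₗ β) := fun φ => by
    rw [← hβ]; exact congr($hb'.symm φ)
  obtain ⟨φN, hφN⟩ := exists_comp_eq_of_ker_le hp.surjective (p ∘ₗ α) fun x hx => by
    obtain ⟨y, rfl⟩ := (hp.exact x).1 hx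
    have : α (f y) = f (β y) := congr($hαβ y)
    simp [this, hp.exact.apply_apply_eq_zero]
  have hφN' : ∀ x, φN (p x) = p (α x) := fun x => congr($hφN x)
  have hαβ' : ∀ x, α (f x) = f (β x) := fun x => congr($hαβ x)
  rcases hN φN with ⟨m, hm⟩ | hb
  · left
    have h1 : ∀ m x, (φN ^ m) (p x) = p (((α : Module.End R P₀) ^ m) x) := fun m => by
      induction m with
      | zero => simp
      | succ m ih => intro x; rw [pow_succ, pow_succ, Module.End.mul_apply, hφN', ih]; rfl
    have h2 : ∀ m x, ((α : Module.End R P₀) ^ m) (f x) = f (((β : Module.End R P₁) ^ m) x) :=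
      fun m => by
        induction m with
        | zero => simp
        | succ m ih => intro x; rw [pow_succ, pow_succ, Module.End.mul_apply, hαβ', ih]; rfl
    -- The map `α ^ m` factors as `f s`. So `ψ ^ m` is induced by `β ^ m - s f`, which is nilpotent
    -- because its range is contained in the superfluous submodule `ker f`.
    obtain ⟨s, hs⟩ := Module.projective_lifting_property f.rangeRestrict
      (((α : Module.End R P₀) ^ m).codRestrict (LinearMap.range f) fun x => by
        refine (hp.exact _).1 ?_
        rw [← h1, hm, LinearMap.zero_apply]) (LinearMap.surjective_rangeRestrict _)
    have hs' : ∀ x, f (s x) = ((α : Module.End R P₀) ^ m) x := fun x => congr((($hs x : _) : P₀))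
    let γ : Module.End R P₁ := (β : Module.End R P₁) ^ m - s ∘ₗ f
    obtain ⟨j, hj⟩ := isNilpotent_of_range_superfluous hp.superfluous_one γ (by
      rintro _ ⟨x, rfl⟩
      rw [LinearMap.mem_ker, LinearMap.sub_apply, map_sub, ← h2, LinearMap.comp_apply, hs',
        sub_self])
    have h3 : ∀ m φ, (ψ ^ m) (q φ) = q (φ ∘ₗ (β : Module.End R P₁) ^ m) := fun m => by
      induction m with
      | zero => intro φ; rfl
      | succ m ih =>
        intro φ
        rw [pow_succ, Module.End.mul_apply, hψq, ih, pow_succ']; rfl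
    have h4 : ∀ φ, (ψ ^ m) (q φ) = q (φ ∘ₗ γ) := fun φ => by
      rw [h3, ← sub_eq_zero, ← map_sub]
      refine (Submodule.Quotient.mk_eq_zero _).2 ⟨φ ∘ₗ s, LinearMap.ext fun x => ?_⟩
      simp [γ]
    have h5 : ∀ j φ, ((ψ ^ m) ^ j) (q φ) = q (φ ∘ₗ γ ^ j) := fun j => by
      induction j with
      | zero => intro φ; rfl
      | succ j ih =>
        intro φ
        rw [pow_succ, Module.End.mul_apply, h4, ih, pow_succ']; rfl
    refine ⟨m * j, LinearMap.ext fun v => ?_⟩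
    obtain ⟨φ, rfl⟩ := hqs v
    rw [pow_mul, h5, hj, LinearMap.zero_apply]
    exact congr(q $(LinearMap.comp_zero φ)).trans (map_zero q)
  · right
    -- By minimality `α` and `β` are surjective along with `φN`.
    have hαs : Function.Surjective α := by
      rw [← LinearMap.range_eq_top]
      refine hp.superfluous_zero _ (eq_top_iff.2 fun x _ => ?_)
      obtain ⟨n, hn⟩ := hb.2 (p x)
      obtain ⟨y, rfl⟩ := hp.surjective n
      rw [hφN'] at hn
      rw [← sub_add_cancel x (α y)]
      exact Submodule.add_mem_sup (by rw [LinearMap.mem_ker, map_sub, hn, sub_self]) ⟨y, rfl⟩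
    have hβs : Function.Surjective β := by
      rw [← LinearMap.range_eq_top]
      refine hp.superfluous_one _ (eq_top_iff.2 fun x _ => ?_)
      obtain ⟨y, hy⟩ := hαs (f x)
      have hy0 : p y = 0 := hb.1 (by
        rw [hφN', hy, hp.exact.apply_apply_eq_zero, map_zero])
      obtain ⟨z, rfl⟩ := (hp.exact y).1 hy0
      rw [← sub_add_cancel x (β z)]
      exact Submodule.add_mem_sup
        (by rw [LinearMap.mem_ker, map_sub, ← hαβ', hy, sub_self]) ⟨z, rfl⟩
    have hβb := IsNoetherian.bijective_of_surjective_endomorphism β hβs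
    let bβ := LinearEquiv.ofBijective β hβb
    refine IsNoetherian.bijective_of_surjective_endomorphism ψ fun v => ?_
    obtain ⟨φ, rfl⟩ := hqs v
    refine ⟨q (φ ∘ₗ bβ.symm.toLinearMap), ?_⟩
    rw [hψq]
    congr 1
    ext x
    exact congr(φ $(bβ.symm_apply_apply x))

/-- Non-bijective endomorphisms form a proper subspace if every endomorphism is nilpotent or
bijective; hence some functional kills all of them, but not the identity. -/
theorem exists_functional_of_local {N : Type u} [AddCommGroup N] [Module R N] [Nontrivial N]
    [Module k N] [IsScalarTower k R N]
    (hN : ∀ φ : Module.End R N, IsNilpotent φ ∨ Function.Bijective φ) :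
    ∃ ξ : (N →ₗ[R] N) →ₗ[k] k, ξ LinearMap.id = 1 ∧
      ∀ φ : N →ₗ[R] N, ¬ Function.Bijective φ → ξ φ = 0 := by
  let I : Submodule k (N →ₗ[R] N) :=
    { carrier := {φ | ¬ Function.Bijective φ}
      zero_mem' := fun h => by
        obtain ⟨x, hx⟩ := exists_ne (0 : N)
        exact hx (h.1 rfl)
      add_mem' := fun {a b} ha hb h => by
        let u := LinearEquiv.ofBijective (a + b) h
        let a' : Module.End R N := u.symm.toLinearMap ∘ₗ a
        let b' : Module.End R N := u.symm.toLinearMap ∘ₗ b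
        have hab : a' + b' = 1 := LinearMap.ext fun x => by
          change u.symm (a x) + u.symm (b x) = x
          rw [← map_add]
          exact u.symm_apply_apply x
        have ha' : ¬ Function.Bijective a' := fun h' => ha (by
          have : (a : N → N) = u ∘ a' := by ext x; simp [a']
          rw [this]; exact u.bijective.comp h')
        have hb' : ¬ Function.Bijective b' := fun h' => hb (by
          have : (b : N → N) = u ∘ b' := by ext x; simp [b']
          rw [this]; exact u.bijective.comp h')
        have h1 : IsNilpotent a' := (hN a').resolve_right ha'
        have h2 : IsUnit b' := by
          rw [eq_sub_of_add_eq' hab]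
          exact h1.isUnit_one_sub
        exact hb' ((Module.End.isUnit_iff b').1 h2)
      smul_mem' := fun c φ hφ h => hφ (by
        rcases eq_or_ne c 0 with rfl | hc
        · rw [zero_smul] at h
          obtain ⟨x, hx⟩ := exists_ne (0 : N)
          exact (hx (h.1 rfl)).elim
        · refine ⟨fun x y hxy => h.1 ?_, fun y => ?_⟩
          · rw [LinearMap.smul_apply, LinearMap.smul_apply, hxy]
          · obtain ⟨x, hx⟩ := h.2 y
            refine ⟨c • x, ?_⟩
            rw [← hx, LinearMap.smul_apply, ← algebraMap_smul R c x, map_smul, algebraMap_smul]) }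
  have hid : (LinearMap.id : N →ₗ[R] N) ∉ I := fun h => h Function.bijective_id
  obtain ⟨ξ, h1, h2⟩ := Submodule.exists_le_ker_of_notMem hid
  refine ⟨(ξ LinearMap.id)⁻¹ • ξ, ?_, fun φ hφ => ?_⟩
  · rw [LinearMap.smul_apply, smul_eq_mul, inv_mul_cancel₀ h1]
  · have : ξ φ = 0 := h2 (show φ ∈ I from hφ)
    rw [LinearMap.smul_apply, this, smul_zero]

/-- Existence of almost split sequences starting at an indecomposable non-injective module `U`.
Let `P₁ → P₀ → N → 0` be a minimal projective presentation of the dual `N` of `U`. A functional on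
`End N` which kills the non-automorphisms but not the identity extends to `Hom(P₀, N)`, and then
corresponds to a map `t : P₀* → U`. The almost split sequence is the pushout along `t` of
`P₀* → P₁* → V → 0`. -/
theorem exists_isAlmostSplit (hB : IsRegularBimodule k R S e) {U : ModuleCat.{u} S}
    [Module.Finite S U] (hUi : CategoryTheory.Indecomposable U) (hU : ¬ Module.Injective S U)
    {P₁ P₀ N : Type u} [AddCommGroup P₁] [Module R P₁] [AddCommGroup P₀] [Module R P₀]
    [AddCommGroup N] [Module R N] (d : DualPair k R S e N U) {f : P₁ →ₗ[R] P₀} {p : P₀ →ₗ[R] N}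
    (hp : IsMinimalProjectivePresentation f p) :
    ∃ (X : ModuleCat.{u} S) (f' : U →ₗ[S] X) (g : X →ₗ[S] ModuleCat.of S
      ((P₁ →ₗ[R] B) ⧸ LinearMap.range (LinearMap.lcomp S B f))), IsAlmostSplit f' g := by
  have := IsNoetherianRing.of_finite k S
  have := IsNoetherianRing.of_finite k R
  have := IsArtinianRing.of_finite k S
  have := IsArtinianRing.of_finite k R
  have hNfin : Module.Finite R N := (d.symm hB).finite_right hB.symm
  have := hp.finite_one
  have := hp.finite_zero
  have := hp.projective_one
  have := hp.projective_zero
  obtain ⟨hf1, hp1⟩ := finite_projective_dual (P := P₁) hB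
  obtain ⟨hf0, hp0⟩ := finite_projective_dual (P := P₀) hB
  have hUφ := isNilpotent_or_bijective_of_indecomposable hUi
  have hNφ := d.isNilpotent_or_bijective hB hUφ
  have hNnt : Nontrivial N := by
    by_contra hN
    rw [not_nontrivial_iff_subsingleton] at hN
    refine hUi.1 (ModuleCat.isZero_of_iff_subsingleton.2 ?_)
    exact ⟨fun x y => d.ext_right fun m => by rw [Subsingleton.elim m 0]; simp⟩
  let : Module k N := Module.compHom N (algebraMap k R)
  have : IsScalarTower k R N := ⟨fun c r m => by rw [Algebra.smul_def, mul_smul]; rfl⟩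
  obtain ⟨ξ, hξ1, hξ⟩ := exists_functional_of_local (k := k) hNφ
  -- The functional extends from `End N` to `Hom(P₀, N)`.
  obtain ⟨ξ', hξ'⟩ : ∃ ξ' : (P₀ →ₗ[R] N) →ₗ[k] k, ∀ c, ξ' (c ∘ₗ p) = ξ c := by
    obtain ⟨r, hr⟩ := (LinearMap.lcomp k N p).exists_leftInverse_of_injective
      (LinearMap.ker_eq_bot.2 fun c c' h => LinearMap.ext fun n => by
        obtain ⟨x, rfl⟩ := hp.surjective n
        exact congr($h x))
    exact ⟨ξ ∘ₗ r, fun c => congr(ξ ($hr c))⟩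
  have hfactor : ∀ {L : Type u} [AddCommGroup L] [Module R L] (c : P₀ →ₗ[R] L), c ∘ₗ f = 0 →
      ∃ c' : N →ₗ[R] L, c' ∘ₗ p = c := fun c hc =>
    exists_comp_eq_of_ker_le hp.surjective c fun x hx => by
      obtain ⟨y, rfl⟩ := (hp.exact x).1 hx
      exact congr($hc y)
  obtain ⟨t, ht⟩ := d.exists_hom_of_functional hB ξ'
  let fs := LinearMap.lcomp S B f
  -- Endomorphisms of `N` which factor through `R` are not bijective, since `U` is not injective.
  have htker : ∀ φ, fs φ = 0 → t φ = 0 := fun φ hφ => d.sep_right _ fun u => by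
    obtain ⟨φ', rfl⟩ := hfactor φ hφ
    rw [ht, show rankOne hB (φ' ∘ₗ p) u = rankOne hB φ' u ∘ₗ p from rfl, hξ']
    refine hξ _ fun hb => hU ?_
    let b := LinearEquiv.ofBijective _ hb
    have : Module.Projective R N := Module.Projective.of_split
      ((hB.equiv.symm.toLinearMap ∘ₗ φ') ∘ₗ b.symm.toLinearMap) (LinearMap.toSpanSingleton R N u)
      (LinearMap.ext fun x => b.apply_symm_apply x)
    exact d.injective_of_projective hB
  let K : Submodule S (U × (P₁ →ₗ[R] B)) := LinearMap.range (t.prod (-fs))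
  let f' : U →ₗ[S] (U × (P₁ →ₗ[R] B)) ⧸ K := K.mkQ ∘ₗ LinearMap.inl S U _
  let q := (LinearMap.range fs).mkQ
  let g : ((U × (P₁ →ₗ[R] B)) ⧸ K) →ₗ[S] ((P₁ →ₗ[R] B) ⧸ LinearMap.range fs) :=
    K.liftQ (q ∘ₗ LinearMap.snd S U _) (by
      rintro _ ⟨φ, rfl⟩
      exact (Submodule.Quotient.mk_eq_zero _).2 ⟨-φ, by simp⟩)
  have hK : ∀ φ, K.mkQ (t φ, -fs φ) = 0 := fun φ =>
    (Submodule.Quotient.mk_eq_zero _).2 ⟨φ, rfl⟩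
  have hK' : ∀ φ, K.mkQ (0, fs φ) = f' (t φ) := fun φ => by
    rw [eq_comm, ← sub_eq_zero, ← hK φ, LinearMap.comp_apply, ← map_sub]
    simp
  refine ⟨ModuleCat.of S ((U × (P₁ →ₗ[R] B)) ⧸ K), f', g, ?_⟩
  have : Module.Finite S (ModuleCat.of S ((U × (P₁ →ₗ[R] B)) ⧸ K)) :=
    inferInstanceAs (Module.Finite S ((U × (P₁ →ₗ[R] B)) ⧸ K))
  have : Module.Finite S (ModuleCat.of S ((P₁ →ₗ[R] B) ⧸ LinearMap.range fs)) :=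
    inferInstanceAs (Module.Finite S ((P₁ →ₗ[R] B) ⧸ LinearMap.range fs))
  refine isAlmostSplit_of_left ?_ ?_ ?_ ?_ ?_ (isNilpotent_or_bijective_transpose hB hp hNφ)
  · refine (injective_iff_map_eq_zero f').2 fun u hu => ?_
    obtain ⟨φ, hφ⟩ := (Submodule.Quotient.mk_eq_zero _).1 hu
    have h1 : t φ = u := congr(Prod.fst $hφ)
    have h2 : -fs φ = 0 := congr(Prod.snd $hφ)
    rw [← h1, htker φ (neg_eq_zero.1 h2)]
  · intro x
    obtain ⟨⟨u, φ⟩, rfl⟩ := K.mkQ_surjective x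
    constructor
    · intro h
      obtain ⟨φ', rfl⟩ := (Submodule.Quotient.mk_eq_zero _).1 (show q φ = 0 from h)
      refine ⟨u + t φ', ?_⟩
      rw [map_add, ← hK']
      change K.mkQ (u, 0) + _ = _
      rw [← map_add]
      simp [fs]
    · rintro ⟨u', h⟩
      rw [← h]
      exact map_zero q
  · intro v
    obtain ⟨φ, rfl⟩ := Submodule.mkQ_surjective _ v
    exact ⟨K.mkQ (0, φ), rfl⟩
  · rintro ⟨r, hr⟩
    let b : (P₁ →ₗ[R] B) →ₗ[S] U := r ∘ₗ K.mkQ ∘ₗ LinearMap.inr S U _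
    have hb : ∀ φ, b (fs φ) = t φ := fun φ => (congr(r $(hK' φ))).trans congr($hr (t φ))
    obtain ⟨η, hη⟩ := d.exists_functional_of_hom hB b
    have h1 : ξ' = η ∘ₗ LinearMap.lcomp k N f := functional_ext hB fun φ n => by
      rw [← ht, ← hb, hη]; rfl
    have h2 : ξ' (LinearMap.id ∘ₗ p) = η (p ∘ₗ f) := congr($h1 p)
    rw [hξ', hξ1, hp.exact.linearMap_comp_eq_zero, map_zero] at h2
    exact one_ne_zero h2
  · intro W h hW hh
    obtain ⟨NW, ⟨dW'⟩⟩ := exists_dualPair hB.symm W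
    have := dW'.finite_right hB.symm
    let dW := dW'.symm hB.symm
    obtain ⟨Dh, hDh⟩ := (d.symm hB).exists_transpose hB.symm dW' h
    let : Module k NW := Module.compHom NW (algebraMap k R)
    have : IsScalarTower k R NW := ⟨fun c r m => by rw [Algebra.smul_def, mul_smul]; rfl⟩
    let ξW : (P₀ →ₗ[R] NW) →ₗ[k] k :=
      ξ' ∘ₗ
        { toFun := fun c => Dh ∘ₗ c
          map_add' := fun c c' => LinearMap.comp_add _ _ _
          map_smul' := fun a c => LinearMap.ext fun x => by
            simp only [LinearMap.comp_apply, LinearMap.smul_apply, RingHom.id_apply]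
            rw [← algebraMap_smul R a (c x), map_smul, algebraMap_smul] }
    obtain ⟨w, hw⟩ := dW.exists_extension hB f (t := h ∘ₗ t) (ξ := ξW)
      (fun φ n => by
        have h1 := hDh (t φ) n
        rw [DualPair.symm_form] at h1
        change dW'.form (h (t φ)) n = ξ' (Dh ∘ₗ rankOne hB φ n)
        rw [← h1, ht, comp_rankOne])
      (fun c hc => by
        obtain ⟨c', rfl⟩ := hfactor c hc
        change ξ' ((Dh ∘ₗ c') ∘ₗ p) = 0
        rw [hξ']
        refine hξ _ fun hb => hh ?_
        let b := LinearEquiv.ofBijective _ hb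
        obtain ⟨s, hs⟩ := d.exists_transpose hB dW (c' ∘ₗ b.symm.toLinearMap)
        refine ⟨s, LinearMap.ext fun u => d.ext_right fun n => ?_⟩
        rw [LinearMap.comp_apply, hs, LinearMap.id_apply]
        have h1 := hDh u (c' (b.symm n))
        rw [DualPair.symm_form] at h1
        exact h1.symm.trans congr(d.form $(b.apply_symm_apply n) u))
    refine ⟨K.liftQ (h.coprod w) ?_, LinearMap.ext fun u => ?_⟩
    · rintro _ ⟨φ, rfl⟩
      have h1 : w (fs φ) = h (t φ) := hw φ
      simp [h1]
    · change h u + w 0 = h u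
      rw [map_zero, add_zero]

end

/-! ### Vanishing of extension groups -/

section

open CategoryTheory CategoryTheory.Abelian

variable {R : Type u} [Ring R]

variable (R) in
/-- The group `Ext^i_R(M, N)` vanishes. -/
abbrev ExtZero (M N : Type u) [AddCommGroup M] [Module R M] [AddCommGroup N] [Module R N]
    (i : ℕ) : Prop :=
  Subsingleton (Ext (ModuleCat.of R M) (ModuleCat.of R N) i)

variable {X Y Z T W : Type u} [AddCommGroup X] [Module R X] [AddCommGroup Y] [Module R Y]
  [AddCommGroup Z] [Module R Z] [AddCommGroup T] [Module R T] [AddCommGroup W] [Module R W]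
  {f : X →ₗ[R] Y} {g : Y →ₗ[R] Z}

theorem shortExact_of_linearMap (hf : Function.Injective f) (hg : Function.Surjective g)
    (hfg : Function.Exact f g) :
    (ShortComplex.moduleCatMk f g hfg.linearMap_comp_eq_zero).ShortExact where
  exact := by
    rw [ShortComplex.moduleCat_exact_iff]
    exact fun x hx => (hfg x).1 hx
  mono_f := (ModuleCat.mono_iff_injective _).2 hf
  epi_g := (ModuleCat.epi_iff_surjective _).2 hg

theorem extZero_zero_iff : ExtZero R T W 0 ↔ ∀ h : T →ₗ[R] W, h = 0 := by
  rw [ExtZero, Ext.homEquiv₀.subsingleton_congr]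
  refine ⟨fun H h => ?_, fun H => ⟨fun a b => ?_⟩⟩
  · exact congr(ModuleCat.Hom.hom $(H.elim (ModuleCat.ofHom h) 0))
  · exact ModuleCat.hom_ext ((H a.hom).trans (H b.hom).symm)

theorem extZero_of_projective [Module.Projective R T] {i : ℕ} (hi : 1 ≤ i) : ExtZero R T W i := by
  obtain ⟨j, rfl⟩ := Nat.exists_eq_add_of_le' hi
  exact Ext.subsingleton_of_projective _ _ _

theorem extZero_of_injective (h : Module.Injective R W) {i : ℕ} (hi : 1 ≤ i) :
    ExtZero R T W i := by
  obtain ⟨j, rfl⟩ := Nat.exists_eq_add_of_le' hi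
  have := Module.injective_object_of_injective_module R W
  exact Ext.subsingleton_of_injective _ _ _

theorem extZero_of_retract_right {i : ℕ} (a : X →ₗ[R] Y) (b : Y →ₗ[R] X)
    (hab : b ∘ₗ a = LinearMap.id) (h : ExtZero R T Y i) : ExtZero R T X i := by
  refine subsingleton_of_forall_eq 0 fun x => ?_
  have h1 : ModuleCat.ofHom a ≫ ModuleCat.ofHom b = 𝟙 (ModuleCat.of R X) :=
    ModuleCat.hom_ext hab
  rw [← x.comp_mk₀_id, ← h1, ← Ext.mk₀_comp_mk₀,
    ← Ext.comp_assoc (h := by omega) (h₁₂ := add_zero i) (h₂₃ := add_zero 0),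
    h.elim (x.comp (Ext.mk₀ (ModuleCat.ofHom a)) (add_zero i)) 0, Ext.zero_comp]

theorem extZero_congr_right {i : ℕ} (a : X ≃ₗ[R] Y) (h : ExtZero R T Y i) : ExtZero R T X i :=
  extZero_of_retract_right a.toLinearMap a.symm.toLinearMap (by ext; simp) h

theorem extZero_congr_left {i : ℕ} (a : X ≃ₗ[R] Y) (h : ExtZero R Y T i) : ExtZero R X T i := by
  refine subsingleton_of_forall_eq 0 fun x => ?_
  have h1 : a.toModuleIso.hom ≫ a.toModuleIso.inv = 𝟙 (ModuleCat.of R X) :=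
    a.toModuleIso.hom_inv_id
  rw [← x.mk₀_id_comp, ← h1, ← Ext.mk₀_comp_mk₀,
    Ext.comp_assoc (h := by omega) (h₁₂ := add_zero 0) (h₂₃ := zero_add i),
    h.elim ((Ext.mk₀ a.toModuleIso.inv).comp x (zero_add i)) 0, Ext.comp_zero]

variable (hf : Function.Injective f) (hg : Function.Surjective g) (hfg : Function.Exact f g)

include hf hg hfg

/-- If `Ext^(i-1)(T, Z)` vanishes, then `Ext^i(T, X) → Ext^i(T, Y)` is injective. -/
theorem ext_postcomp_injective {i : ℕ} (hZ : ∀ j, j + 1 = i → ExtZero R T Z j)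
    (x : Ext (ModuleCat.of R T) (ModuleCat.of R X) i)
    (hx : x.comp (Ext.mk₀ (ModuleCat.ofHom f)) (add_zero i) = 0) : x = 0 := by
  have hS := shortExact_of_linearMap hf hg hfg
  rcases i with _ | i
  · have : Mono (ModuleCat.ofHom f) := hS.mono_f
    exact Ext.postcomp_mk₀_injective_of_mono _ (ModuleCat.ofHom f)
      (hx.trans (Ext.zero_comp _ _ _ _ (add_zero 0)).symm)
  · obtain ⟨z, rfl⟩ := Ext.covariant_sequence_exact₁ _ hS x hx rfl
    have := hZ i rfl
    have hz : z = 0 := Subsingleton.elim (α := Ext (ModuleCat.of R T) (ModuleCat.of R Z) i) _ _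
    rw [hz, Ext.zero_comp]
    rfl

theorem extZero_left_of_exact {i : ℕ} (hY : ExtZero R T Y i)
    (hZ : ∀ j, j + 1 = i → ExtZero R T Z j) : ExtZero R T X i :=
  subsingleton_of_forall_eq 0 fun x =>
    ext_postcomp_injective hf hg hfg hZ x (hY.elim _ _)

theorem extZero_right_of_exact {i : ℕ} (hY : ExtZero R T Y i) (hX : ExtZero R T X (i + 1)) :
    ExtZero R T Z i := by
  have hS := shortExact_of_linearMap hf hg hfg
  refine subsingleton_of_forall_eq 0 fun z => ?_
  obtain ⟨y, rfl⟩ := Ext.covariant_sequence_exact₃ _ hS z rfl (hX.elim _ _)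
  have hy : y = 0 := hY.elim _ _
  rw [hy, Ext.zero_comp]
  rfl

theorem extZero_left_of_exact' {i : ℕ} (hY : ExtZero R Y W i) (hZ : ExtZero R Z W (i + 1)) :
    ExtZero R X W i := by
  have hS := shortExact_of_linearMap hf hg hfg
  refine subsingleton_of_forall_eq 0 fun z => ?_
  obtain ⟨y, rfl⟩ := Ext.contravariant_sequence_exact₁ hS _ z (add_comm 1 i) (hZ.elim _ _)
  have hy : y = 0 := hY.elim _ _
  rw [hy, Ext.comp_zero]
  rfl

theorem extZero_right_of_exact' {i : ℕ} (hY : ExtZero R Y W (i + 1)) (hX : ExtZero R X W i) :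
    ExtZero R Z W (i + 1) := by
  have hS := shortExact_of_linearMap hf hg hfg
  refine subsingleton_of_forall_eq 0 fun z => ?_
  obtain ⟨y, rfl⟩ := Ext.contravariant_sequence_exact₃ hS _ z (hY.elim _ _) (add_comm 1 i)
  have hy : y = 0 := hX.elim _ _
  rw [hy, Ext.comp_zero]
  rfl

/-- If `Ext¹(Z, W)` vanishes, then maps `X → W` extend to `Y`. -/
theorem exists_extension_of_extZero (hZ : ExtZero R Z W 1) (h : X →ₗ[R] W) :
    ∃ h' : Y →ₗ[R] W, h' ∘ₗ f = h := by
  have hS := shortExact_of_linearMap hf hg hfg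
  obtain ⟨y, hy⟩ := Ext.contravariant_sequence_exact₁ hS _ (Ext.mk₀ (ModuleCat.ofHom h))
    (n₁ := 1) rfl (hZ.elim _ _)
  obtain ⟨y, rfl⟩ := Ext.homEquiv₀.symm.surjective y
  refine ⟨y.hom, ?_⟩
  have h1 : Ext.mk₀ (ModuleCat.ofHom f ≫ y) = Ext.mk₀ (ModuleCat.ofHom h) :=
    (Ext.mk₀_comp_mk₀ _ _).symm.trans hy
  exact congr(ModuleCat.Hom.hom $((Ext.mk₀_bijective _ _).1 h1))

/-- If `Ext¹(T, X)` vanishes, then maps `T → Z` lift to `Y`. -/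
theorem exists_lift_of_extZero (hX : ExtZero R T X 1) (h : T →ₗ[R] Z) :
    ∃ h' : T →ₗ[R] Y, g ∘ₗ h' = h := by
  have hS := shortExact_of_linearMap hf hg hfg
  obtain ⟨y, hy⟩ := Ext.covariant_sequence_exact₃ _ hS (Ext.mk₀ (ModuleCat.ofHom h))
    (n₁ := 1) rfl (hX.elim _ _)
  obtain ⟨y, rfl⟩ := Ext.homEquiv₀.symm.surjective y
  refine ⟨y.hom, ?_⟩
  have h1 : Ext.mk₀ (y ≫ ModuleCat.ofHom g) = Ext.mk₀ (ModuleCat.ofHom h) :=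
    (Ext.mk₀_comp_mk₀ _ _).symm.trans hy
  exact congr(ModuleCat.Hom.hom $((Ext.mk₀_bijective _ _).1 h1))

/-- If `Y` is projective and every map `X → W` extends to `Y`, then `Ext¹(Z, W)` vanishes. -/
theorem extZero_one_of_exists_extension [Module.Projective R Y]
    (h : ∀ h : X →ₗ[R] W, ∃ h' : Y →ₗ[R] W, h' ∘ₗ f = h) : ExtZero R Z W 1 := by
  have hS := shortExact_of_linearMap hf hg hfg
  refine subsingleton_of_forall_eq 0 fun z => ?_
  obtain ⟨x, rfl⟩ := Ext.contravariant_sequence_exact₃ hS _ z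
    ((extZero_of_projective (R := R) (T := Y) (W := W) le_rfl).elim _ _) (n₀ := 0) rfl
  obtain ⟨x, rfl⟩ := Ext.homEquiv₀.symm.surjective x
  obtain ⟨y, hy⟩ := h x.hom
  have h1 : x = ModuleCat.ofHom f ≫ ModuleCat.ofHom y := ModuleCat.hom_ext hy.symm
  subst h1
  exact congr(hS.extClass.comp $((Ext.mk₀_comp_mk₀ (ModuleCat.ofHom f) (ModuleCat.ofHom y)).symm)
    rfl).trans (hS.extClass_comp_assoc (Ext.mk₀ (ModuleCat.ofHom y)) (h := rfl))

end

section

variable {k R S B : Type u} [Field k] [Ring R] [Ring S] [Algebra k R] [Algebra k S]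
  [AddCommGroup B] [Module R B] [Module S B] [SMulCommClass R S B] [SMulCommClass S R B] {e : B}
  [Module.Finite k R] [Module.Finite k S]

/-- Duality for extension groups: `Ext^i(D B, D T) = 0` for `1 ≤ i ≤ m` implies
`Ext^i(T, B) = 0` for `1 ≤ i ≤ m`, by dimension shifting. -/
theorem extZero_of_dualPair (hB : IsRegularBimodule k R S e) {DB : Type u} [AddCommGroup DB]
    [Module S DB] (dB : DualPair k R S e B DB) (m : ℕ) {T N : Type u} [AddCommGroup T] [Module R T]
    [Module.Finite R T] [AddCommGroup N] [Module S N] (d : DualPair k R S e T N)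
    (h : ∀ i, 1 ≤ i → i ≤ m → ExtZero S DB N i) : ∀ i, 1 ≤ i → i ≤ m → ExtZero R T B i := by
  have := IsNoetherianRing.of_finite k R
  induction m generalizing T N with
  | zero => intro i h1 h2; omega
  | succ m ih =>
    have : Module.Finite R B := Module.Finite.equiv hB.equiv
    have := dB.finite_right hB
    obtain ⟨n, p, hp⟩ := Module.Finite.exists_fin' R T
    obtain ⟨NF, ⟨dF⟩⟩ := exists_dualPair hB (Fin n → R)
    obtain ⟨NK, ⟨dK⟩⟩ := exists_dualPair hB (LinearMap.ker p)
    let i := (LinearMap.ker p).subtype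
    have hi : Function.Injective i := Submodule.injective_subtype _
    have hip : Function.Exact i p := LinearMap.exact_subtype_ker_map p
    obtain ⟨p', hp'⟩ := dF.exists_transpose hB d p
    obtain ⟨i', hi'⟩ := dK.exists_transpose hB dF i
    have hp'inj := dF.injective_of_surjective d hp' hp
    have hi'surj := dK.surjective_of_injective hB dF hi' hi
    have hex := dK.exact_of_exact hB dF d hi' hp' hip hp
    have hFi := dF.injective_of_projective hB
    have hK := ih dK fun j h1 h2 => extZero_right_of_exact hp'inj hi'surj hex
      (extZero_of_injective hFi h1) (h _ (by omega) (by omega))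
    intro j h1 h2
    rcases Nat.lt_or_ge 1 j with hj | hj
    · obtain ⟨j, rfl⟩ := Nat.exists_eq_add_of_le' h1
      exact extZero_right_of_exact' hi hp hip (extZero_of_projective h1)
        (hK j (by omega) (by omega))
    · obtain rfl : j = 1 := by omega
      refine extZero_one_of_exists_extension hi hp hip fun φ => ?_
      obtain ⟨φ', hφ'⟩ := dK.exists_transpose hB dB φ
      obtain ⟨ψ', hψ'⟩ := exists_lift_of_extZero hp'inj hi'surj hex (h 1 le_rfl (by omega)) φ'
      obtain ⟨ψ, hψ⟩ := (dB.symm hB).exists_transpose hB.symm (dF.symm hB) ψ'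
      refine ⟨ψ, LinearMap.ext fun x => dB.ext_left fun y => ?_⟩
      have h3 := hψ y (i x)
      simp only [DualPair.symm_form] at h3
      rw [LinearMap.comp_apply, h3, ← hi', ← LinearMap.comp_apply, hψ', hφ']

end

/-! ### Depth with respect to the torsion class of the projective-injective modules -/

section

variable (R : Type u) [Ring R]

/-- The module `T` is torsion: it has no nonzero maps to finitely generated modules which are
projective and injective. -/
def IsTorsion (T : Type u) [AddCommGroup T] [Module R T] : Prop :=
  ∀ E : ModuleCat.{u} R, Module.Finite R E → Module.Projective R E → Module.Injective R E →
    ∀ h : T →ₗ[R] E, h = 0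

/-- The module `M` has torsion depth at least `m`: `Ext^i(T, M) = 0` for all torsion modules `T`
and all `i < m`. For finitely generated modules over a finite-dimensional algebra this is equivalent
to having dominant dimension at least `m`. -/
def HasTorsionDepth (M : Type u) [AddCommGroup M] [Module R M] (m : ℕ) : Prop :=
  ∀ T : ModuleCat.{u} R, IsTorsion R T → ∀ i < m, ExtZero R T M i

variable {R}

theorem HasTorsionDepth.mono {M : Type u} [AddCommGroup M] [Module R M] {m n : ℕ}
    (h : HasTorsionDepth R M n) (hmn : m ≤ n) : HasTorsionDepth R M m :=
  fun T hT i hi => h T hT i (by omega)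

theorem hasTorsionDepth_of_projective_of_injective {M : Type u} [AddCommGroup M] [Module R M]
    (h1 : Module.Finite R M) (h2 : Module.Projective R M) (h3 : Module.Injective R M) (m : ℕ) :
    HasTorsionDepth R M m := by
  intro T hT i _
  rcases Nat.eq_zero_or_pos i with rfl | hi
  · exact extZero_zero_iff.2 (hT (ModuleCat.of R M) h1 h2 h3)
  · exact extZero_of_injective h3 hi

theorem HasTorsionDepth.congr {M M' : Type u} [AddCommGroup M] [Module R M] [AddCommGroup M']
    [Module R M'] {m : ℕ} (h : HasTorsionDepth R M m) (a : M' ≃ₗ[R] M) : HasTorsionDepth R M' m :=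
  fun T hT i hi => extZero_congr_right a (h T hT i hi)

theorem extZero_of_subsingleton_left {T W : Type u} [AddCommGroup T] [Module R T] [AddCommGroup W]
    [Module R W] [Subsingleton T] (i : ℕ) : ExtZero R T W i := by
  rcases Nat.eq_zero_or_pos i with rfl | hi
  · exact extZero_zero_iff.2 fun h => LinearMap.ext fun x => by
      rw [Subsingleton.elim x 0, map_zero, map_zero]
  · exact extZero_of_projective hi

end

/-! ### Depth of duals -/

section

variable {k R S B : Type u} [Field k] [Ring R] [Ring S] [Algebra k R] [Algebra k S]
  [AddCommGroup B] [Module R B] [Module S B] [SMulCommClass R S B] [SMulCommClass S R B] {e : B}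

/-- Let `π : F → Z` be a map with kernel `K` from a projective module, and `m ≥ 2`. If enough
extension groups `Ext(-, B)` of `Z` and of the cokernel of `π` vanish, then the cokernel of
`Z* → F*` is contained in `K*`, and is equal to `K*` if `m ≥ 3`. -/
theorem extZero_coker_dual {T F Z : Type u} [AddCommGroup T] [Module S T] [AddCommGroup F]
    [Module R F] [AddCommGroup Z] [Module R Z] (π : F →ₗ[R] Z) (m : ℕ)
    (hC : ∀ i < m, ExtZero R (Z ⧸ LinearMap.range π) B i)
    (hZ : ∀ i, 1 ≤ i → i + 2 ≤ m → ExtZero R Z B i)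
    (hK : ∀ i, i + 1 < m → ExtZero S T (LinearMap.ker π →ₗ[R] B) i) (i : ℕ) (hi : i + 1 < m) :
    ExtZero S T ((F →ₗ[R] B) ⧸ LinearMap.range (LinearMap.lcomp S B π)) i := by
  let res := LinearMap.lcomp S B (LinearMap.ker π).subtype
  have hex : Function.Exact (LinearMap.lcomp S B π) res := fun φ => by
    constructor
    · intro h
      obtain ⟨φ', hφ'⟩ := exists_comp_eq_of_ker_le π.surjective_rangeRestrict φ fun x hx => by
        rw [LinearMap.ker_rangeRestrict] at hx
        exact congr($h ⟨x, hx⟩)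
      obtain ⟨ψ, hψ⟩ := exists_extension_of_extZero (Submodule.injective_subtype _)
        (Submodule.mkQ_surjective _) (LinearMap.exact_subtype_mkQ (LinearMap.range π))
        (hC 1 (by omega)) φ'
      refine ⟨ψ, LinearMap.ext fun x => ?_⟩
      rw [← hφ', ← hψ]
      rfl
    · rintro ⟨ψ, rfl⟩
      ext x
      have hx : π x = 0 := x.2
      simp [res, hx]
  let j := (LinearMap.range (LinearMap.lcomp S B π)).liftQ res hex.linearMap_ker_eq.ge
  have hj : Function.Injective j :=
    LinearMap.ker_eq_bot.1 (Submodule.ker_liftQ_eq_bot' _ _ hex.linearMap_ker_eq.symm)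
  rcases Nat.eq_zero_or_pos i with rfl | hi0
  · rw [extZero_zero_iff]
    intro h
    have h0 := extZero_zero_iff.1 (hK 0 hi) (j ∘ₗ h)
    exact LinearMap.ext fun x => hj (congr($h0 x).trans (map_zero j).symm)
  · have hsurj : Function.Surjective j := fun ψ => by
      have h1 : ExtZero R (LinearMap.range π) B 1 := extZero_left_of_exact'
        (Submodule.injective_subtype _) (Submodule.mkQ_surjective _)
        (LinearMap.exact_subtype_mkQ (LinearMap.range π)) (hZ 1 le_rfl (by omega))
        (hC 2 (by omega))
      obtain ⟨φ, hφ⟩ := exists_extension_of_extZero (f := (LinearMap.ker π).subtype)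
        (g := π.rangeRestrict) (Submodule.injective_subtype _) π.surjective_rangeRestrict
        (by rw [LinearMap.exact_iff, LinearMap.ker_rangeRestrict, Submodule.range_subtype]) h1 ψ
      exact ⟨Submodule.Quotient.mk φ, hφ⟩
    exact extZero_congr_right (LinearEquiv.ofBijective j ⟨hj, hsurj⟩) (hK i hi)

/-- If every finitely generated `R`-module `Z` admits a map `F → Z` from a projective module such
that `Ext^i(-, B)` vanishes on the cokernel for `i < m`, and such that `Ext^i(T, F*) = 0` for
`i < m`, then `Ext^i(T, Z*) = 0` for `i < j` and any `j ≤ m`, as soon as `Ext^i(Z, B) = 0` for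
`1 ≤ i ≤ j - 2`. -/
theorem extZero_dual [IsNoetherianRing R] {T : Type u} [AddCommGroup T] [Module S T] (m : ℕ)
    (H : ∀ Z : ModuleCat.{u} R, Module.Finite R Z → ∃ (F : ModuleCat.{u} R) (π : F →ₗ[R] Z),
      Module.Finite R F ∧ Module.Projective R F ∧
      (∀ i < m, ExtZero R (Z ⧸ LinearMap.range π) B i) ∧ ∀ i < m, ExtZero S T (F →ₗ[R] B) i)
    (j : ℕ) (hj : j ≤ m) (Z : Type u) [AddCommGroup Z] [Module R Z] [Module.Finite R Z]
    (hZ : ∀ i, 1 ≤ i → i + 2 ≤ j → ExtZero R Z B i) : ∀ i < j, ExtZero S T (Z →ₗ[R] B) i := by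
  induction j generalizing Z with
  | zero => intro i hi; omega
  | succ j ih =>
    obtain ⟨F, π, hF1, hF2, hC, hF⟩ := H (ModuleCat.of R Z) ‹_›
    change F →ₗ[R] Z at π
    change ∀ i < m, ExtZero R (Z ⧸ LinearMap.range π) B i at hC
    have hr : ∀ i, 1 ≤ i → i + 2 ≤ j + 1 → ExtZero R (LinearMap.range π) B i := fun i h1 h2 =>
      extZero_left_of_exact' (Submodule.injective_subtype _) (Submodule.mkQ_surjective _)
        (LinearMap.exact_subtype_mkQ (LinearMap.range π)) (hZ i h1 h2) (hC (i + 1) (by omega))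
    have hK := ih (by omega) (LinearMap.ker π) fun i h1 h2 => extZero_left_of_exact'
      (f := (LinearMap.ker π).subtype) (g := π.rangeRestrict) (Submodule.injective_subtype _)
      π.surjective_rangeRestrict
      (by rw [LinearMap.exact_iff, LinearMap.ker_rangeRestrict, Submodule.range_subtype])
      (extZero_of_projective h1) (hr (i + 1) (by omega) (by omega))
    have hcok := extZero_coker_dual (T := T) (S := S) π (j + 1) (fun i hi => hC i (by omega)) hZ
      (fun i hi => hK i (by omega))
    have hinj : Function.Injective (LinearMap.lcomp S B π) := by
      refine (injective_iff_map_eq_zero _).2 fun φ hφ => ?_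
      obtain ⟨ψ, rfl⟩ := exists_comp_eq_of_ker_le (Submodule.mkQ_surjective (LinearMap.range π)) φ
        fun x hx => by
          rw [Submodule.ker_mkQ] at hx
          obtain ⟨y, rfl⟩ := hx
          exact congr($hφ y)
      rw [extZero_zero_iff.1 (hC 0 (by omega)) ψ, LinearMap.zero_comp]
    intro i hi
    exact extZero_left_of_exact hinj (Submodule.mkQ_surjective _) (LinearMap.exact_map_mkQ_range _)
      (hF i (by omega)) fun l hl => hcok l (by omega)

/-- If the transpose of `X` satisfies `Ext^i(Tr X, B) = 0` for `1 ≤ i ≤ n`, where `n ≥ 1`, then `X`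
embeds in a projective module `Q`, and if projective modules have torsion depth at least `n - 1`,
then so has `Q / X`. Indeed, `Q` is the dual of a free module mapping onto `X*`; for `n ≥ 2` the
module `X` is reflexive, and the cokernel is controlled by `extZero_coker_dual`. -/
theorem exists_embedding_of_extZero_transpose [Module.Finite k R] [Module.Finite k S]
    (hB : IsRegularBimodule k R S e) {P₁ P₀ X : Type u}
    [AddCommGroup P₁] [Module R P₁] [AddCommGroup P₀] [Module R P₀]
    [AddCommGroup X] [Module R X] {f : P₁ →ₗ[R] P₀} {p : P₀ →ₗ[R] X}
    (hp : IsMinimalProjectivePresentation f p) (n : ℕ) (hn : 1 ≤ n)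
    (hT : ∀ i, 1 ≤ i → i ≤ n →
      ExtZero S ((P₁ →ₗ[R] B) ⧸ LinearMap.range (LinearMap.lcomp S B f)) B i)
    (hproj : ∀ P : ModuleCat.{u} R, Module.Finite R P → Module.Projective R P →
      HasTorsionDepth R P (n - 1)) :
    ∃ (Q : ModuleCat.{u} R) (j : X →ₗ[R] Q), Module.Finite R Q ∧ Module.Projective R Q ∧
      Function.Injective j ∧ HasTorsionDepth R (Q ⧸ LinearMap.range j) (n - 1) := by
  have := IsNoetherianRing.of_finite k S
  have := hp.finite_one
  have := hp.finite_zero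
  have := hp.projective_one
  have := hp.projective_zero
  obtain ⟨hf1, hp1⟩ := finite_projective_dual (P := P₁) hB
  obtain ⟨hf0, hp0⟩ := finite_projective_dual (P := P₀) hB
  let fs := LinearMap.lcomp S B f
  let ps := LinearMap.lcomp S B p
  have hps : Function.Injective ps := fun φ ψ h => LinearMap.ext fun x => by
    obtain ⟨y, rfl⟩ := hp.surjective x
    exact congr($h y)
  have hXfin : Module.Finite S (X →ₗ[R] B) := Module.Finite.of_injective ps hps
  have hex : Function.Exact ps fs := fun φ => by
    constructor
    · intro h
      obtain ⟨ψ, rfl⟩ := exists_comp_eq_of_ker_le hp.surjective φ fun x hx => by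
        obtain ⟨y, rfl⟩ := (hp.exact x).1 hx
        exact congr($h y)
      exact ⟨ψ, rfl⟩
    · rintro ⟨ψ, rfl⟩
      ext x
      exact congr(ψ $(hp.exact.apply_apply_eq_zero x)).trans (map_zero ψ)
  have hex' : Function.Exact ps fs.rangeRestrict := by
    rw [LinearMap.exact_iff, LinearMap.ker_rangeRestrict, hex.linearMap_ker_eq]
  have hΩ : ∀ i, 1 ≤ i → i + 1 ≤ n → ExtZero S (LinearMap.range fs) B i := fun i h1 h2 =>
    extZero_left_of_exact' (Submodule.injective_subtype _) (Submodule.mkQ_surjective _)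
      (LinearMap.exact_subtype_mkQ (LinearMap.range fs)) (extZero_of_projective h1)
      (hT (i + 1) (by omega) h2)
  have hX : ∀ i, 1 ≤ i → i + 2 ≤ n → ExtZero S (X →ₗ[R] B) B i := fun i h1 h2 =>
    extZero_left_of_exact' hps fs.surjective_rangeRestrict hex' (extZero_of_projective h1)
      (hΩ (i + 1) (by omega) h2)
  have hev : Function.Injective (evalDual R S B X) := by
    refine (injective_iff_map_eq_zero _).2 fun x hx => ?_
    obtain ⟨y, rfl⟩ := hp.surjective x
    obtain ⟨Φ, hΦ⟩ := exists_comp_eq_of_ker_le fs.surjective_rangeRestrict (evalDual R S B P₀ y)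
      fun φ hφ => by
        rw [LinearMap.ker_rangeRestrict] at hφ
        obtain ⟨ψ, rfl⟩ := (hex φ).1 hφ
        exact congr($hx ψ)
    obtain ⟨Ψ, hΨ⟩ := exists_extension_of_extZero (Submodule.injective_subtype _)
      (Submodule.mkQ_surjective _) (LinearMap.exact_subtype_mkQ (LinearMap.range fs))
      (hT 1 le_rfl hn) Φ
    obtain ⟨q, rfl⟩ := (bijective_evalDual (P := P₁) hB).2 Ψ
    have : y = f q := (bijective_evalDual (P := P₀) hB).1 <| LinearMap.ext fun φ => by
      rw [← hΦ, ← hΨ]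
      rfl
    rw [this, hp.exact.apply_apply_eq_zero]
  obtain ⟨l, π, hπ⟩ := Module.Finite.exists_fin' S (X →ₗ[R] B)
  obtain ⟨hQ1, hQ2⟩ := finite_projective_dual (P := Fin l → S) hB.symm
  let πs := LinearMap.lcomp R B π
  have hπs : Function.Injective πs := fun φ ψ h => LinearMap.ext fun x => by
    obtain ⟨y, rfl⟩ := hπ x
    exact congr($h y)
  refine ⟨ModuleCat.of R ((Fin l → S) →ₗ[S] B), πs ∘ₗ evalDual R S B X, hQ1, hQ2,
    hπs.comp hev, fun T hTt i hi => ?_⟩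
  have hevs : Function.Surjective (evalDual R S B X) := fun Φ => by
    obtain ⟨Ψ, hΨ⟩ := exists_extension_of_extZero hps fs.surjective_rangeRestrict hex'
      (hΩ 1 le_rfl (by omega)) Φ
    obtain ⟨y, rfl⟩ := (bijective_evalDual (P := P₀) hB).2 Ψ
    refine ⟨p y, ?_⟩
    rw [← hΨ]
    rfl
  have hrange : LinearMap.range (πs ∘ₗ evalDual R S B X) = LinearMap.range πs := by
    rw [LinearMap.range_comp, LinearMap.range_eq_top.2 hevs, Submodule.map_top]
  have hsub : ∀ {F Z : Type u} [AddCommGroup F] [Module S F] [AddCommGroup Z] [Module S Z]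
      (π : F →ₗ[S] Z), Function.Surjective π → ∀ i, ExtZero S (Z ⧸ LinearMap.range π) B i :=
    fun π hπ i => by
      have := Submodule.Quotient.subsingleton_iff.2 (LinearMap.range_eq_top.2 hπ)
      exact extZero_of_subsingleton_left i
  refine extZero_congr_right (Submodule.quotEquivOfEq _ _ hrange) ?_
  refine extZero_coker_dual (T := T) π n (fun i _ => hsub π hπ i) hX (fun i hi => ?_) i (by omega)
  refine extZero_dual (T := T) (n - 1) (fun Z hZ => ?_) (n - 1) le_rfl _ (fun i h1 h2 => ?_) i
    (by omega)
  · obtain ⟨l', π', hπ'⟩ := Module.Finite.exists_fin' S Z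
    obtain ⟨h1, h2⟩ := finite_projective_dual (P := Fin l' → S) hB.symm
    exact ⟨ModuleCat.of S (Fin l' → S), π', inferInstanceAs (Module.Finite S (Fin l' → S)),
      inferInstanceAs (Module.Projective S (Fin l' → S)), fun i _ => hsub π' hπ' i,
      hproj (ModuleCat.of R ((Fin l' → S) →ₗ[S] B)) h1 h2 T hTt⟩
  · exact extZero_left_of_exact' (Submodule.injective_subtype _) hπ
      (LinearMap.exact_subtype_ker_map π) (extZero_of_projective h1) (hX (i + 1) (by omega)
      (by omega))

end

/-! ### Radical maps between projective modules -/

section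

open CategoryTheory CategoryTheory.Abelian

variable {R : Type u} [Ring R]

/-- The radical of a finitely generated projective module `P` is contained in `J P`, where `J` is
the Jacobson radical of the ring, because `P` is a retract of a free module. -/
theorem jacobson_le_smul_top {P : Type u} [AddCommGroup P] [Module R P] [Module.Finite R P]
    [Module.Projective R P] : Module.jacobson R P ≤ Ring.jacobson R • (⊤ : Submodule R P) := by
  obtain ⟨l, b, hb⟩ := Module.Finite.exists_fin' R P
  obtain ⟨a, ha⟩ := Module.projective_lifting_property b LinearMap.id hb
  intro x hx
  have h1 : a x ∈ Module.jacobson R (Fin l → R) := Module.le_comap_jacobson a hx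
  have h2 := Module.jacobson_pi_le R (fun _ : Fin l => R) h1
  have h3 : x = ∑ i, a x i • b (Pi.single i 1) := by
    refine congr($ha x).symm.trans ?_
    rw [LinearMap.comp_apply]
    conv_lhs => rw [pi_eq_sum_univ' (a x), map_sum]
    refine Finset.sum_congr rfl fun i _ => ?_
    rw [map_smul]
  rw [h3]
  exact Submodule.sum_mem _ fun i _ =>
    Submodule.smul_mem_smul (h2 i trivial) Submodule.mem_top

/-- A map `q : U → Q` to a projective module whose image is not contained in the radical of `Q`
is a split monomorphism if `U` is indecomposable: `q` followed by a map to some simple module `S` is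
onto, so `Q → S` factors as `Q → U → Q → S`, and the endomorphism `U → Q → U` is not
nilpotent. -/
theorem range_le_jacobson_of_not_split [IsArtinianRing R] [IsNoetherianRing R]
    {U : ModuleCat.{u} R} [Module.Finite R U]
    (hU : Indecomposable U) {Q : Type u} [AddCommGroup Q] [Module R Q] [Module.Projective R Q]
    (q : U →ₗ[R] Q) (hq : ¬ ∃ r : Q →ₗ[R] U, r ∘ₗ q = LinearMap.id) :
    LinearMap.range q ≤ Module.jacobson R Q := by
  refine le_sInf fun N hN => ?_
  by_contra hle
  have hsup : N ⊔ LinearMap.range q = ⊤ := hN.2 _ (left_lt_sup.2 hle)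
  have hsurj : Function.Surjective (N.mkQ ∘ₗ q) := by
    rw [← LinearMap.range_eq_top, LinearMap.range_comp]
    exact (Submodule.map_mkQ_eq_top N (LinearMap.range q)).2 hsup
  obtain ⟨s, hs⟩ := Module.projective_lifting_property (N.mkQ ∘ₗ q) N.mkQ hsurj
  have hpow : ∀ l : ℕ, N.mkQ ∘ₗ q ∘ₗ ((s ∘ₗ q : Module.End R U) ^ l) = N.mkQ ∘ₗ q := by
    intro l
    induction l with
    | zero => rfl
    | succ l ih =>
      rw [pow_succ, Module.End.mul_eq_comp, ← LinearMap.comp_assoc, ← LinearMap.comp_assoc,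
        LinearMap.comp_assoc _ q, ih, ← LinearMap.comp_assoc, hs]
  rcases isNilpotent_or_bijective_of_indecomposable hU (s ∘ₗ q) with ⟨l, hl⟩ | hbij
  · have h0 := hpow l
    rw [hl, LinearMap.comp_zero, LinearMap.comp_zero] at h0
    rw [← h0] at hsurj
    refine hN.1 (Submodule.Quotient.subsingleton_iff.1 ⟨fun x y => ?_⟩)
    obtain ⟨a, rfl⟩ := hsurj x
    obtain ⟨b, rfl⟩ := hsurj y
    rfl
  · let φ := LinearEquiv.ofBijective (s ∘ₗ q) hbij
    exact hq ⟨φ.symm.toLinearMap ∘ₗ s, LinearMap.ext fun x => φ.symm_apply_apply x⟩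

/-- The condition that `Ext^i(T, q)` is injective for all torsion modules `T` and all `i < n`. -/
def ReflectsTorsionExt (n : ℕ) {P Q : Type u} [AddCommGroup P] [Module R P] [AddCommGroup Q]
    [Module R Q] (q : P →ₗ[R] Q) : Prop :=
  ∀ T : ModuleCat.{u} R, IsTorsion R T → ∀ i < n,
    ∀ x : Ext (ModuleCat.of R T) (ModuleCat.of R P) i,
      x.comp (Ext.mk₀ (ModuleCat.ofHom q)) (add_zero i) = 0 → x = 0

section

variable {n : ℕ} {P Q Q' : Type u} [AddCommGroup P] [Module R P] [AddCommGroup Q] [Module R Q]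
  [AddCommGroup Q'] [Module R Q']

theorem comp_mk₀_comp {T : Type u} [AddCommGroup T] [Module R T] {i : ℕ}
    (q : P →ₗ[R] Q) (q' : Q →ₗ[R] Q') (x : Ext (ModuleCat.of R T) (ModuleCat.of R P) i) :
    x.comp (Ext.mk₀ (ModuleCat.ofHom (q' ∘ₗ q))) (add_zero i) =
      (x.comp (Ext.mk₀ (ModuleCat.ofHom q)) (add_zero i)).comp
        (Ext.mk₀ (ModuleCat.ofHom q')) (add_zero i) := by
  rw [Ext.comp_assoc (h := by omega) (h₁₂ := add_zero i) (h₂₃ := add_zero 0),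
    Ext.mk₀_comp_mk₀, ModuleCat.ofHom_comp]

theorem ReflectsTorsionExt.comp {q : P →ₗ[R] Q} {q' : Q →ₗ[R] Q'}
    (h' : ReflectsTorsionExt n q') (h : ReflectsTorsionExt n q) :
    ReflectsTorsionExt n (q' ∘ₗ q) := fun T hT i hi x hx =>
  h T hT i hi x (h' T hT i hi _ ((comp_mk₀_comp q q' x).symm.trans hx))

theorem reflectsTorsionExt_id : ReflectsTorsionExt n (LinearMap.id : P →ₗ[R] P) :=
  fun _ _ _ _ x hx => (x.comp_mk₀_id).symm.trans hx

theorem HasTorsionDepth.reflectsTorsionExt (h : HasTorsionDepth R P n) (q : P →ₗ[R] Q) :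
    ReflectsTorsionExt n q := fun T hT i hi x _ => (h T hT i hi).elim x 0

theorem hasTorsionDepth_of_reflectsTorsionExt_zero
    (h : ReflectsTorsionExt n (0 : P →ₗ[R] Q)) : HasTorsionDepth R P n := fun T hT i hi =>
  subsingleton_of_forall_eq 0 fun x => h T hT i hi x <| by
    have : ModuleCat.ofHom (0 : P →ₗ[R] Q) = 0 := rfl
    rw [this, Ext.mk₀_zero, Ext.comp_zero]

theorem reflectsTorsionExt_of_injective {f : P →ₗ[R] Q} (hf : Function.Injective f)
    (h : HasTorsionDepth R (Q ⧸ LinearMap.range f) (n - 1)) : ReflectsTorsionExt n f :=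
  fun T hT i hi x hx => ext_postcomp_injective hf (Submodule.mkQ_surjective _)
    (LinearMap.exact_map_mkQ_range f) (fun j hj => h T hT j (by omega)) x hx

/-- If the identity of `P` factors jointly through `a` and `b`, and the maps `q` and `q'` reflect
extensions by torsion modules, then so does `(q a, q' b)`. -/
theorem ReflectsTorsionExt.prod {Y Z : Type u} [AddCommGroup Y] [Module R Y] [AddCommGroup Z]
    [Module R Z] {a : P →ₗ[R] Y} {b : P →ₗ[R] Z} {a' : Y →ₗ[R] P} {b' : Z →ₗ[R] P}
    (hab : a' ∘ₗ a + b' ∘ₗ b = LinearMap.id) {q : Y →ₗ[R] Q} {q' : Z →ₗ[R] Q'}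
    (h : ReflectsTorsionExt n q) (h' : ReflectsTorsionExt n q') :
    ReflectsTorsionExt n ((q ∘ₗ a).prod (q' ∘ₗ b)) := fun T hT i hi x hx => by
  have ha := h T hT i hi (x.comp (Ext.mk₀ (ModuleCat.ofHom a)) (add_zero i)) <| by
    rw [← comp_mk₀_comp, ← LinearMap.fst_prod (q ∘ₗ a) (q' ∘ₗ b), comp_mk₀_comp, hx, Ext.zero_comp]
  have hb := h' T hT i hi (x.comp (Ext.mk₀ (ModuleCat.ofHom b)) (add_zero i)) <| by
    rw [← comp_mk₀_comp, ← LinearMap.snd_prod (q ∘ₗ a) (q' ∘ₗ b), comp_mk₀_comp, hx, Ext.zero_comp]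
  have hid : 𝟙 (ModuleCat.of R P) = ModuleCat.ofHom (a' ∘ₗ a) + ModuleCat.ofHom (b' ∘ₗ b) :=
    ModuleCat.hom_ext hab.symm
  rw [← x.comp_mk₀_id, hid, Ext.mk₀_add, Ext.comp_add, comp_mk₀_comp, comp_mk₀_comp, ha, hb,
    Ext.zero_comp, Ext.zero_comp, add_zero]

end

/-- `P` has a radical map to a finitely generated projective module which reflects extensions by
torsion modules. -/
def HasRadicalEmbedding (n : ℕ) (P : Type u) [AddCommGroup P] [Module R P] : Prop :=
  ∃ (Q : ModuleCat.{u} R) (q : P →ₗ[R] Q), Module.Finite R Q ∧ Module.Projective R Q ∧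
    LinearMap.range q ≤ Ring.jacobson R • (⊤ : Submodule R Q) ∧ ReflectsTorsionExt n q

/-- The existence of radical maps extends from indecomposable modules to their direct sums. -/
theorem hasRadicalEmbedding_of_indecomposable [IsArtinianRing R] [IsNoetherianRing R] (n : ℕ)
    (H : ∀ U : ModuleCat.{u} R, Module.Finite R U → Indecomposable U → Module.Projective R U →
      HasRadicalEmbedding (R := R) n U)
    (P : ModuleCat.{u} R) (h1 : Module.Finite R P) (h2 : Module.Projective R P) :
    HasRadicalEmbedding (R := R) n P := by
  induction hl : Module.length R P using WellFoundedLT.induction generalizing P with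
  | ind l ih =>
  subst hl
  by_cases hP : Indecomposable P
  · exact H P h1 hP h2
  by_cases hP0 : Limits.IsZero P
  · have := ModuleCat.subsingleton_of_isZero hP0
    have h0 : (0 : P →ₗ[R] P) = LinearMap.id := Subsingleton.elim _ _
    refine ⟨P, 0, h1, h2, ?_, by rw [h0]; exact reflectsTorsionExt_id⟩
    rw [LinearMap.range_zero]
    exact bot_le
  simp only [Indecomposable, not_and, not_forall, not_or] at hP
  obtain ⟨Y, Z, e, hY, hZ⟩ := hP hP0
  let a : P →ₗ[R] Y := (e.hom ≫ Limits.biprod.fst).hom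
  let b : P →ₗ[R] Z := (e.hom ≫ Limits.biprod.snd).hom
  let a' : Y →ₗ[R] P := (Limits.biprod.inl ≫ e.inv).hom
  let b' : Z →ₗ[R] P := (Limits.biprod.inr ≫ e.inv).hom
  have hab : a' ∘ₗ a + b' ∘ₗ b = LinearMap.id := by
    have : (e.hom ≫ Limits.biprod.fst) ≫ (Limits.biprod.inl ≫ e.inv) +
        (e.hom ≫ Limits.biprod.snd) ≫ (Limits.biprod.inr ≫ e.inv) = 𝟙 P := by
      simp only [Category.assoc, ← Preadditive.comp_add]
      simp only [← Category.assoc, ← Preadditive.add_comp, Limits.biprod.total]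
      simp
    exact congr(ModuleCat.Hom.hom $this)
  have haa : a ∘ₗ a' = LinearMap.id := by
    have : (Limits.biprod.inl ≫ e.inv) ≫ (e.hom ≫ Limits.biprod.fst) = 𝟙 Y := by simp
    exact congr(ModuleCat.Hom.hom $this)
  have hbb : b ∘ₗ b' = LinearMap.id := by
    have : (Limits.biprod.inr ≫ e.inv) ≫ (e.hom ≫ Limits.biprod.snd) = 𝟙 Z := by simp
    exact congr(ModuleCat.Hom.hom $this)
  have hba : b ∘ₗ a' = 0 := by
    have : (Limits.biprod.inl ≫ e.inv) ≫ (e.hom ≫ Limits.biprod.snd) = (0 : Y ⟶ Z) := by simp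
    exact congr(ModuleCat.Hom.hom $this)
  have hab0 : a ∘ₗ b' = 0 := by
    have : (Limits.biprod.inr ≫ e.inv) ≫ (e.hom ≫ Limits.biprod.fst) = (0 : Z ⟶ Y) := by simp
    exact congr(ModuleCat.Hom.hom $this)
  have key : ∀ {Y Z : ModuleCat.{u} R} (a : P →ₗ[R] Y) (a' : Y →ₗ[R] P) (b : P →ₗ[R] Z)
      (b' : Z →ₗ[R] P), a ∘ₗ a' = LinearMap.id → b ∘ₗ b' = LinearMap.id → b ∘ₗ a' = 0 →
      ¬ Limits.IsZero Z → HasRadicalEmbedding (R := R) n Y := by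
    intro Y Z a a' b b' haa hbb hba hZ
    have hinj : Function.Injective a' := fun x y h =>
      congr($haa x).symm.trans ((congrArg a h).trans congr($haa y))
    have hsurj : Function.Surjective a := fun x => ⟨a' x, congr($haa x)⟩
    refine ih (Module.length R Y) ?_ Y (Module.Finite.of_surjective a hsurj)
      (Module.Projective.of_split a' a haa) rfl
    rw [(LinearEquiv.ofInjective a' hinj).length_eq]
    refine Submodule.length_lt fun htop => hZ ?_
    have hb0 : b = 0 := LinearMap.ext fun x => by
      obtain ⟨y, rfl⟩ := LinearMap.range_eq_top.1 htop x
      exact congr($hba y)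
    have : Subsingleton Z := subsingleton_of_forall_eq 0 fun z => by
      have := congr($hbb z)
      rw [hb0] at this
      exact this.symm
    exact ModuleCat.isZero_of_subsingleton Z
  obtain ⟨Q, q, hQ1, hQ2, hq, hqr⟩ := key a a' b b' haa hbb hba hZ
  obtain ⟨Q', q', hQ1', hQ2', hq', hqr'⟩ := key b b' a a' hbb haa hab0 hY
  refine ⟨ModuleCat.of R (Q × Q'), (q ∘ₗ a).prod (q' ∘ₗ b),
    inferInstanceAs (Module.Finite R (Q × Q')), inferInstanceAs (Module.Projective R (Q × Q')), ?_,
    ReflectsTorsionExt.prod hab hqr hqr'⟩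
  rintro _ ⟨x, rfl⟩
  have hsum : ((q ∘ₗ a).prod (q' ∘ₗ b)) x =
      LinearMap.inl R Q Q' (q (a x)) + LinearMap.inr R Q Q' (q' (b x)) := by simp
  have hmap : ∀ {C D : Type u} [AddCommGroup C] [Module R C] [AddCommGroup D] [Module R D]
      (g : C →ₗ[R] D) (c : C), c ∈ Ring.jacobson R • (⊤ : Submodule R C) →
      g c ∈ Ring.jacobson R • (⊤ : Submodule R D) := fun g c hc =>
    Submodule.smul_mono le_rfl le_top (Submodule.map_smul'' _ _ g ▸ Submodule.mem_map_of_mem hc)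
  change ((q ∘ₗ a).prod (q' ∘ₗ b)) x ∈ Ring.jacobson R • (⊤ : Submodule R (Q × Q'))
  rw [hsum]
  exact Submodule.add_mem _ (hmap _ _ (hq ⟨a x, rfl⟩)) (hmap _ _ (hq' ⟨b x, rfl⟩))

/-- Composites of sufficiently many radical maps vanish. -/
theorem hasTorsionDepth_of_hasRadicalEmbedding [IsArtinianRing R] (n : ℕ)
    (H : ∀ P : ModuleCat.{u} R, Module.Finite R P → Module.Projective R P →
      HasRadicalEmbedding (R := R) n P)
    (P : ModuleCat.{u} R) (h1 : Module.Finite R P) (h2 : Module.Projective R P) :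
    HasTorsionDepth R P n := by
  have key : ∀ m : ℕ, ∃ (Q : ModuleCat.{u} R) (q : P →ₗ[R] Q), Module.Finite R Q ∧
      Module.Projective R Q ∧
      LinearMap.range q ≤ (Ring.jacobson R) ^ m • (⊤ : Submodule R Q) ∧
      ReflectsTorsionExt n q := by
    intro m
    induction m with
    | zero =>
      refine ⟨P, LinearMap.id, h1, h2, ?_, reflectsTorsionExt_id⟩
      rw [Submodule.pow_zero, Ideal.one_eq_top, Submodule.top_smul]
      exact le_top
    | succ m ih =>
      obtain ⟨Q, q, hQ1, hQ2, hq, hqr⟩ := ih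
      obtain ⟨Q', q', hQ1', hQ2', hq', hqr'⟩ := H Q hQ1 hQ2
      refine ⟨Q', q' ∘ₗ q, hQ1', hQ2', ?_, hqr'.comp hqr⟩
      rw [LinearMap.range_comp, Submodule.pow_succ, ← smul_eq_mul, Submodule.smul_assoc]
      refine (Submodule.map_mono hq).trans ?_
      rw [Submodule.map_smul'', Submodule.map_top]
      exact Submodule.smul_mono le_rfl hq'
  obtain ⟨m, hm⟩ := IsSemiprimaryRing.isNilpotent (R := R)
  obtain ⟨Q, q, _, _, hq, hqr⟩ := key m
  have hq0 : q = 0 := by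
    rw [hm] at hq
    refine LinearMap.range_eq_bot.1 (le_bot_iff.1 (hq.trans ?_))
    rw [Ideal.zero_eq_bot, Submodule.bot_smul]
  subst hq0
  exact hasTorsionDepth_of_reflectsTorsionExt_zero hqr

end

/-! ### Projective right modules have large torsion depth -/

section

variable {k A : Type u} [Field k] [Ring A] [Algebra k A] [Module.Finite k A]

theorem IsTorsionFree.mono {m n : ℕ} {M : ModuleCat.{u} Aᵐᵒᵖ} (h : IsTorsionFree k A n M)
    (hmn : m ≤ n) : IsTorsionFree k A m M := by
  obtain ⟨N, hN, h⟩ := h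
  exact ⟨N, hN, fun i h1 h2 => h i h1 (h2.trans hmn)⟩

/-- A torsion-free module embeds in a projective module with cokernel of large torsion depth. -/
theorem IsTorsionFree.exists_embedding {m : ℕ} {X : ModuleCat.{u} Aᵐᵒᵖ}
    (hX : IsTorsionFree k A (m + 1) X)
    (hproj : ∀ P : ModuleCat.{u} Aᵐᵒᵖ, Module.Finite Aᵐᵒᵖ P → Module.Projective Aᵐᵒᵖ P →
      HasTorsionDepth Aᵐᵒᵖ P m) :
    ∃ (Q : ModuleCat.{u} Aᵐᵒᵖ) (j : X →ₗ[Aᵐᵒᵖ] Q), Module.Finite Aᵐᵒᵖ Q ∧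
      Module.Projective Aᵐᵒᵖ Q ∧ Function.Injective j ∧
      HasTorsionDepth Aᵐᵒᵖ (Q ⧸ LinearMap.range j) m := by
  obtain ⟨N, ⟨T, ⟨P₁, P₀, f, p, hp, ⟨t⟩⟩, ⟨a⟩⟩, hN⟩ := hX
  have hr := isRegularBimodule_right k A
  refine exists_embedding_of_extZero_transpose hr hp (m + 1) (by omega) (fun i h1 h2 => ?_) hproj
  have := hp.finite_one
  have := hp.projective_one
  have hfin := (finite_projective_dual (P := P₁) hr).1
  have : Module.Finite A T := Module.Finite.equiv t.symm
  exact extZero_congr_left t.symm <| extZero_of_dualPair (isRegularBimodule_left k A)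
    (stdDualPairLeft k A A) (m + 1) ((stdDualPairLeft k A T).congr (LinearEquiv.refl A T) a) hN i
    h1 h2

/-- The almost split sequence `0 → U → X → τ⁻¹ U → 0` provides a radical map from `U` to a
projective module containing `X`. -/
theorem hasRadicalEmbedding_of_hasTorsionFreeARSequences {m : ℕ}
    (h : HasTorsionFreeARSequences k A (m + 1))
    (hproj : ∀ P : ModuleCat.{u} Aᵐᵒᵖ, Module.Finite Aᵐᵒᵖ P → Module.Projective Aᵐᵒᵖ P →
      HasTorsionDepth Aᵐᵒᵖ P m)
    (U : ModuleCat.{u} Aᵐᵒᵖ) (h1 : Module.Finite Aᵐᵒᵖ U) (hU : CategoryTheory.Indecomposable U)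
    (h2 : Module.Projective Aᵐᵒᵖ U) : HasRadicalEmbedding (R := Aᵐᵒᵖ) (m + 1) U := by
  have := IsNoetherianRing.of_finite k A
  have := IsNoetherianRing.of_finite k Aᵐᵒᵖ
  have := IsArtinianRing.of_finite k A
  have := IsArtinianRing.of_finite k Aᵐᵒᵖ
  by_cases h3 : Module.Injective Aᵐᵒᵖ U
  · refine ⟨U, 0, h1, h2, ?_,
      (hasTorsionDepth_of_projective_of_injective h1 h2 h3 _).reflectsTorsionExt 0⟩
    rw [LinearMap.range_zero]
    exact bot_le
  have hl := isRegularBimodule_left k A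
  have hr := isRegularBimodule_right k A
  have : Module.Finite A (StdDual k Aᵐᵒᵖ U) := (stdDualPairRight k A U).finite_right hr
  obtain ⟨P₁, P₀, f, p, hp⟩ :=
    exists_isMinimalProjectivePresentation (R := A) (StdDual k Aᵐᵒᵖ U)
  obtain ⟨X, f', g, hs⟩ := exists_isAlmostSplit hl hU h3 ((stdDualPairRight k A U).symm hr) hp
  obtain ⟨-, hX, hV⟩ := h U h1 hU h2 h3 X _ f' g
    ⟨P₁, P₀, f, p, hp, ⟨LinearEquiv.refl _ _⟩⟩ hs
  obtain ⟨Q, j, hQ1, hQ2, hj, hjd⟩ := hX.exists_embedding hproj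
  obtain ⟨Q', j', hQ1', hQ2', hj', hjd'⟩ := hV.exists_embedding hproj
  have hVd : HasTorsionDepth Aᵐᵒᵖ _ m := fun T hT i hi => extZero_left_of_exact hj'
    (Submodule.mkQ_surjective _) (LinearMap.exact_map_mkQ_range j') (hproj Q' hQ1' hQ2' T hT i hi)
    fun l hl => hjd' T hT l (by omega)
  have a := (Submodule.quotEquivOfEq _ _ hs.exact.linearMap_ker_eq.symm).trans
    (g.quotKerEquivOfSurjective hs.surjective)
  refine ⟨Q, j ∘ₗ f', hQ1, hQ2, ?_, ?_⟩
  · refine (range_le_jacobson_of_not_split hU _ ?_).trans jacobson_le_smul_top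
    rintro ⟨r, hr⟩
    exact hs.not_split_mono ⟨r ∘ₗ j, hr⟩
  · exact (reflectsTorsionExt_of_injective (n := m + 1) hj hjd).comp
      (reflectsTorsionExt_of_injective (n := m + 1) hs.injective (hVd.congr a))

/-- If the algebra has `n`-torsion-free Auslander-Reiten sequences, then projective right modules
have torsion depth at least `n`, by induction on `n`. -/
theorem hasTorsionDepth_right {n : ℕ} (h : HasTorsionFreeARSequences k A n)
    (P : ModuleCat.{u} Aᵐᵒᵖ) (h1 : Module.Finite Aᵐᵒᵖ P) (h2 : Module.Projective Aᵐᵒᵖ P) :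
    HasTorsionDepth Aᵐᵒᵖ P n := by
  have := IsNoetherianRing.of_finite k Aᵐᵒᵖ
  have := IsArtinianRing.of_finite k Aᵐᵒᵖ
  induction n generalizing P with
  | zero => intro T _ i hi; omega
  | succ m ih =>
    refine hasTorsionDepth_of_hasRadicalEmbedding (m + 1)
      (hasRadicalEmbedding_of_indecomposable (m + 1)
        (hasRadicalEmbedding_of_hasTorsionFreeARSequences h (ih ?_))) P h1 h2
    intro U h1 h2 h3 h4 X V f g hV hs
    obtain ⟨a, b, c⟩ := h U h1 h2 h3 h4 X V f g hV hs
    exact ⟨a.mono (by omega), b.mono (by omega), c.mono (by omega)⟩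

end

/-! ### Symmetry of the torsion depth of projective modules -/

section

theorem injective_prod {R M N : Type u} [Ring R] [AddCommGroup M] [Module R M] [AddCommGroup N]
    [Module R N] (hM : Module.Injective R M) (hN : Module.Injective R N) :
    Module.Injective R (M × N) where
  out X Y _ _ _ _ f hf g := by
    obtain ⟨a, ha⟩ := hM.out f hf (LinearMap.fst R M N ∘ₗ g)
    obtain ⟨b, hb⟩ := hN.out f hf (LinearMap.snd R M N ∘ₗ g)
    exact ⟨a.prod b, fun x => Prod.ext (ha x) (hb x)⟩

variable {k R S B : Type u} [Field k] [Ring R] [Ring S] [Algebra k R] [Algebra k S]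
  [AddCommGroup B] [Module R B] [Module S B] [SMulCommClass R S B] [SMulCommClass S R B] {e : B}
  [Module.Finite k R] [Module.Finite k S]

/-- Let `C` have no nonzero maps from finitely generated projective modules whose `B`-dual is
injective. Then `C` is torsion: if `E` is projective and injective, then so is its `k`-dual, and
maps `C → E` correspond to maps `D E → D C`, hence to functionals on `Hom((D E)*, C)`. -/
theorem isTorsion_of_forall_hom_eq_zero (hB : IsRegularBimodule k R S e) (C : Type u)
    [AddCommGroup C] [Module R C] [Module.Finite R C]
    (H : ∀ F : ModuleCat.{u} R, Module.Finite R F → Module.Projective R F →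
      Module.Injective S (F →ₗ[R] B) → ∀ h : F →ₗ[R] C, h = 0) : IsTorsion R C := by
  intro E h1 h2 h3 h
  obtain ⟨W, ⟨dE⟩⟩ := exists_dualPair hB E
  obtain ⟨DC, ⟨dC⟩⟩ := exists_dualPair hB C
  have hW1 := dE.finite_right hB
  have hW2 := dE.projective_of_injective hB
  have hW3 := dE.injective_of_projective hB
  obtain ⟨hF1, hF2⟩ := finite_projective_dual (P := W) hB.symm
  let a := evalDualEquiv (P := W) hB.symm
  let : Module k C := Module.compHom C (algebraMap k R)
  have : IsScalarTower k R C := ⟨fun c r x => by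
    change (c • r) • x = algebraMap k R c • r • x
    rw [Algebra.smul_def, mul_smul]⟩
  obtain ⟨h', hh⟩ := dC.exists_transpose hB dE h
  obtain ⟨ξ, hξ⟩ := dC.exists_functional_of_hom hB (h' ∘ₗ a.symm.toLinearMap)
  have hF3 : Module.Injective S ((W →ₗ[S] B) →ₗ[R] B) :=
    injective_of_retract a.symm.toLinearMap a.toLinearMap a.apply_symm_apply
  have h0 := H (ModuleCat.of R (W →ₗ[S] B)) hF1 hF2 hF3
  refine LinearMap.ext fun x => dE.sep_left _ fun w => ?_
  rw [← hh]
  have := hξ (a w) x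
  rw [h0 (rankOne hB (a w) x), map_zero] at this
  simpa using this

/-- Every finitely generated module `Z` admits a map with torsion cokernel from a finitely generated
projective module whose `B`-dual is injective: take a map with the largest possible image. -/
theorem exists_hom_isTorsion_coker (hB : IsRegularBimodule k R S e) (Z : Type u)
    [AddCommGroup Z] [Module R Z] [Module.Finite R Z] :
    ∃ (F : ModuleCat.{u} R) (π : F →ₗ[R] Z), Module.Finite R F ∧ Module.Projective R F ∧
      Module.Injective S (F →ₗ[R] B) ∧ IsTorsion R (Z ⧸ LinearMap.range π) := by
  have := IsNoetherianRing.of_finite k R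
  let s : Set (Submodule R Z) := {N | ∃ (F : ModuleCat.{u} R) (π : F →ₗ[R] Z), Module.Finite R F ∧
    Module.Projective R F ∧ Module.Injective S (F →ₗ[R] B) ∧ LinearMap.range π = N}
  have hs : s.Nonempty := by
    refine ⟨⊥, ModuleCat.of R PUnit.{u + 1}, 0, inferInstanceAs (Module.Finite R PUnit.{u + 1}),
      inferInstanceAs (Module.Projective R PUnit.{u + 1}),
      ⟨fun X Y _ _ _ _ f hf g => ⟨0, fun x => ?_⟩⟩, LinearMap.range_zero⟩
    exact LinearMap.ext fun y => by
      rw [Subsingleton.elim y 0, map_zero, map_zero]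
  obtain ⟨N, ⟨F, π, h1, h2, h3, rfl⟩, hmax⟩ := set_has_maximal_iff_noetherian.2 inferInstance s hs
  refine ⟨F, π, h1, h2, h3, isTorsion_of_forall_hom_eq_zero hB _ fun F' h1' h2' h3' h => ?_⟩
  obtain ⟨π', rfl⟩ := Module.projective_lifting_property (LinearMap.range π).mkQ h
    (Submodule.mkQ_surjective _)
  have hinj : Module.Injective S ((F × F') →ₗ[R] B) := by
    have := injective_prod h3 h3'
    exact injective_of_retract (LinearMap.coprodEquiv S).symm.toLinearMap
      (LinearMap.coprodEquiv S).toLinearMap (LinearMap.coprodEquiv S).apply_symm_apply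
  have hnot := hmax (LinearMap.range (π.coprod π')) ⟨ModuleCat.of R (F × F'), π.coprod π',
    inferInstanceAs (Module.Finite R (F × F')), inferInstanceAs (Module.Projective R (F × F')),
    hinj, rfl⟩
  rw [LinearMap.range_coprod, left_lt_sup, not_not] at hnot
  ext x
  simpa using hnot ⟨x, rfl⟩

/-- The symmetry of the torsion depth: if all finitely generated projective `R`-modules have torsion
depth at least `n`, then so have all finitely generated projective `S`-modules. -/
theorem hasTorsionDepth_symm (hB : IsRegularBimodule k R S e) {n : ℕ}
    (h : ∀ P : ModuleCat.{u} R, Module.Finite R P → Module.Projective R P → HasTorsionDepth R P n)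
    (P : ModuleCat.{u} S) (h1 : Module.Finite S P) (h2 : Module.Projective S P) :
    HasTorsionDepth S P n := by
  have := IsNoetherianRing.of_finite k R
  obtain ⟨h3, h4⟩ := finite_projective_dual (P := P) hB.symm
  intro T hT i hi
  refine extZero_congr_right (evalDualEquiv (P := P) hB.symm)
    (extZero_dual (T := T) n (fun Z hZ => ?_) n le_rfl (P →ₗ[S] B)
      (fun i h1 _ => extZero_of_projective h1) i hi)
  obtain ⟨F, π, hF1, hF2, hF3, hC⟩ := exists_hom_isTorsion_coker hB Z
  obtain ⟨hF4, hF5⟩ := finite_projective_dual (P := F) hB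
  exact ⟨F, π, hF1, hF2, h (ModuleCat.of R B) (Module.Finite.equiv hB.equiv)
    (Module.Projective.of_equiv hB.equiv) (ModuleCat.of R (Z ⧸ LinearMap.range π)) hC,
    hasTorsionDepth_of_projective_of_injective hF4 hF5 hF3 n T hT⟩

end

/-! ### Torsion depth and dominant dimension -/

section

variable {R : Type u} [Ring R] [IsArtinianRing R] [IsNoetherianRing R]

/-- A module of positive torsion depth embeds in a projective-injective module: the least kernel of
a map to such a module is torsion. -/
theorem HasTorsionDepth.exists_embedding {M : Type u} [AddCommGroup M] [Module R M]
    [Module.Finite R M] (h : HasTorsionDepth R M 1) :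
    ∃ (E : ModuleCat.{u} R) (ι : M →ₗ[R] E), Module.Finite R E ∧ Module.Projective R E ∧
      Module.Injective R E ∧ Function.Injective ι := by
  let s : Set (Submodule R M) := {N | ∃ (E : ModuleCat.{u} R) (φ : M →ₗ[R] E), Module.Finite R E ∧
    Module.Projective R E ∧ Module.Injective R E ∧ LinearMap.ker φ = N}
  have hs : s.Nonempty := by
    refine ⟨⊤, ModuleCat.of R PUnit.{u + 1}, 0, inferInstanceAs (Module.Finite R PUnit.{u + 1}),
      inferInstanceAs (Module.Projective R PUnit.{u + 1}),
      ⟨fun X Y _ _ _ _ f hf g => ⟨0, fun x => ?_⟩⟩, LinearMap.ker_zero⟩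
    exact Subsingleton.elim (α := PUnit.{u + 1}) _ _
  obtain ⟨N, ⟨E, φ, h1, h2, h3, rfl⟩, hmin⟩ := set_has_minimal_iff_artinian.2 inferInstance s hs
  refine ⟨E, φ, h1, h2, h3, LinearMap.ker_eq_bot.1 ?_⟩
  have hT : IsTorsion R (LinearMap.ker φ) := fun E' h1' h2' h3' g => by
    obtain ⟨φ', hφ'⟩ := h3'.out _ (LinearMap.ker φ).injective_subtype g
    have hnot := hmin (LinearMap.ker (φ.prod φ')) ⟨ModuleCat.of R (E × E'), φ.prod φ',
      inferInstanceAs (Module.Finite R (E × E')), inferInstanceAs (Module.Projective R (E × E')),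
      injective_prod h3 h3', rfl⟩
    rw [LinearMap.ker_prod, inf_lt_left, not_not] at hnot
    exact LinearMap.ext fun x => (hφ' x).symm.trans (hnot x.2)
  have h0 := extZero_zero_iff.1 (h (ModuleCat.of R (LinearMap.ker φ)) hT 0 one_pos)
    (LinearMap.ker φ).subtype
  rw [← Submodule.range_subtype (LinearMap.ker φ), h0, LinearMap.range_zero]

/-- The injective hull of a module which embeds in a projective-injective module is projective. -/
theorem projective_of_isEssential {M I E : Type u} [AddCommGroup M] [Module R M] [AddCommGroup I]
    [Module R I] [AddCommGroup E] [Module R E] (hI : Module.Injective R I)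
    (hE : Module.Injective R E) [Module.Projective R E] {j : M →ₗ[R] I} {ι : M →ₗ[R] E}
    (hj : Function.Injective j) (hess : IsEssential (LinearMap.range j))
    (hι : Function.Injective ι) : Module.Projective R I := by
  obtain ⟨φ, hφ⟩ := hE.out j hj ι
  have hker : LinearMap.ker φ = ⊥ := hess _ <| by
    rw [eq_bot_iff]
    rintro _ ⟨⟨x, rfl⟩, hx⟩
    have : x = 0 := hι <| by rw [← hφ, map_zero]; exact hx
    rw [this, map_zero]
    exact Submodule.zero_mem _
  obtain ⟨r, hr⟩ := hI.out φ (LinearMap.ker_eq_bot.1 hker) LinearMap.id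
  exact Module.Projective.of_split φ r (LinearMap.ext hr)

/-- Torsion depth at least `n` implies dominant dimension at least `n`: the cosyzygies have depth at
least `n`, `n - 1`, and so on, and the injective hull of a module of positive depth is
projective. -/
theorem le_domDim_of_hasTorsionDepth
    (hE : ∀ M : ModuleCat.{u} R, Module.Finite R M → ∃ (E : ModuleCat.{u} R) (ι : M →ₗ[R] E),
      Module.Finite R E ∧ Module.Injective R E ∧ Function.Injective ι)
    (M : Type u) [AddCommGroup M] [Module R M] (hM : Module.Finite R M) {n : ℕ}
    (h : HasTorsionDepth R M n) : (n : ℕ∞) ≤ domDim R M := by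
  have hull : ∀ N : {N : ModuleCat.{u} R // Module.Finite R N},
      ∃ (I : ModuleCat.{u} R) (j : N.1 →ₗ[R] I), Module.Finite R I ∧ Module.Injective R I ∧
        Function.Injective j ∧ IsEssential (LinearMap.range j) := by
    rintro ⟨N, hN⟩
    obtain ⟨E, ι, h1, h2, h3⟩ := hE N hN
    obtain ⟨I, j, -, -, h4, h5, h6, h7, -⟩ := exists_injectiveHull h1 h2 h3
    exact ⟨I, j, h4, h5, h6, h7⟩
  choose I j hfin hinj hj hess using hull
  -- The cosyzygies of `M`.
  let s : ℕ → {N : ModuleCat.{u} R // Module.Finite R N} := fun i =>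
    Nat.rec ⟨ModuleCat.of R M, hM⟩ (fun _ N => ⟨ModuleCat.of R (I N ⧸ LinearMap.range (j N)),
      have := hfin N
      inferInstanceAs (Module.Finite R (I N ⧸ LinearMap.range (j N)))⟩) i
  let q : ∀ i, I (s i) →ₗ[R] (s (i + 1)).1 := fun i => (LinearMap.range (j (s i))).mkQ
  have hq : ∀ i, Function.Surjective (q i) := fun i => Submodule.mkQ_surjective _
  have hjq : ∀ i, Function.Exact (j (s i)) (q i) := fun i => LinearMap.exact_map_mkQ_range _
  have hrange : ∀ i, LinearMap.range (j (s (i + 1)) ∘ₗ q i) = LinearMap.range (j (s (i + 1))) :=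
    fun i => LinearMap.range_comp_of_range_eq_top _ (LinearMap.range_eq_top.2 (hq i))
  have hker : ∀ i, LinearMap.ker (j (s (i + 1)) ∘ₗ q i) = LinearMap.range (j (s i)) := fun i => by
    rw [LinearMap.ker_comp_of_ker_eq_bot _ (LinearMap.ker_eq_bot.2 (hj _))]
    exact (hjq i).linearMap_ker_eq
  have hproj : ∀ N, HasTorsionDepth R N.1 1 → Module.Projective R (I N) := fun N hN => by
    have := N.2
    obtain ⟨E, ι, -, h1, h2, h3⟩ := hN.exists_embedding
    exact projective_of_isEssential (hinj N) h2 (hj N) (hess N) h3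
  have hdepth : ∀ i, HasTorsionDepth R (s i).1 (n - i) := fun i => by
    induction i with
    | zero => exact h
    | succ i ih =>
      intro T hT l hl
      have hp := hproj _ (ih.mono (by omega))
      exact extZero_right_of_exact (hj (s i)) (hq i) (hjq i)
        (hasTorsionDepth_of_projective_of_injective (hfin _) hp (hinj _) (l + 1) T hT l (by omega))
        (ih T hT (l + 1) (by omega))
  let c : MinimalInjectiveCoresolution R M :=
    { I := fun i => I (s i)
      ι := j (s 0)
      d := fun i => j (s (i + 1)) ∘ₗ q i
      injective_term := fun i => hinj _
      injective_ι := hj _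
      exact_zero := LinearMap.exact_iff.2 (hker 0)
      exact_succ := fun i => LinearMap.exact_iff.2 ((hker (i + 1)).trans (hrange i).symm)
      essential_zero := hess _
      essential_succ := fun i => (hrange i).symm ▸ hess _ }
  refine le_sSup ⟨c, fun i hi => ?_⟩
  have hi' : i < n := by exact_mod_cast hi
  exact hproj _ ((hdepth i).mono (by omega))

end

end ARSeq

theorem theorem3p1 (k A : Type u) [Field k] [Ring A] [Algebra k A] [Module.Finite k A]
    (n : ℕ) (hn : 1 ≤ n) (h : ARSeq.HasTorsionFreeARSequences k A n) :
    (n : ℕ∞) ≤ ARSeq.domDim A A ∧ (n : ℕ∞) ≤ ARSeq.domDim Aᵐᵒᵖ A := by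
  have := IsNoetherianRing.of_finite k A
  have := IsNoetherianRing.of_finite k Aᵐᵒᵖ
  have := IsArtinianRing.of_finite k A
  have := IsArtinianRing.of_finite k Aᵐᵒᵖ
  have hl := ARSeq.isRegularBimodule_left k A
  have hr := ARSeq.isRegularBimodule_right k A
  have hright := ARSeq.hasTorsionDepth_right h
  have hfin : Module.Finite Aᵐᵒᵖ A := Module.Finite.equiv hr.equiv
  have hproj : Module.Projective Aᵐᵒᵖ A := Module.Projective.of_equiv hr.equiv
  constructor
  · exact ARSeq.le_domDim_of_hasTorsionDepth
      (fun M hM => ARSeq.exists_embedding_injective hl M) A inferInstance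
      (ARSeq.hasTorsionDepth_symm hr hright (ModuleCat.of A A) (inferInstanceAs (Module.Finite A A))
        (inferInstanceAs (Module.Projective A A)))
  · exact ARSeq.le_domDim_of_hasTorsionDepth
      (fun M hM => ARSeq.exists_embedding_injective hr M) A hfin
      (hright (ModuleCat.of Aᵐᵒᵖ A) hfin hproj)
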